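/- **Model.** Let $n,k,d,e$ be integers with $k,e\ge 1$ and $k\le d\le n-e$, and let $\mathcal M>0$ be real. A file with $\mathcal M$ units of information is stored on $n$ nodes, each holding at most $\alpha$ units. Repeatedly, any $e$ nodes may fail; a central node then contacts any $d$ of the remaining $n-e$ nodes, downloads at most $\beta$ units from each (a function of that helper's current content), and computes the contents of $e$ replacement nodes. Repair is functional: the maps used may depend on the past repairs and the current one, and the new contents need not equal the old ones. A code *withstanding $T$ repairs* is one for which, after every sequence of at most $T$ such repairs, the contents of any $k$ nodes determine the file. Alphabets are finite, and amounts of information are logarithms of alphabet sizes in an arbitrary common unit. *Codes exist* for $(\mathcal M,\alpha,\beta)$ and $T$ if for every $\mathcal M'<\mathcal M$ there is a code withstanding $T$ repairs that stores a file of at least $\mathcal M'$ units with at most $\alpha$ units per node and at most $\beta$ units downloaded per helper. Write $\gamma=d\beta$, $\eta=\lfloor k/e\rfloor$, $r=k-\eta e$, and $$f_r(i)=\frac{2ed\mathcal M}{-k^2-r^2+e(k-r)+2kd-e^2(i^2+i)-2ier},\qquad g_r(i)=\frac{(\eta-i)(-2r+e+2d-\eta e-ei)}{2d}.$$ Let $\gamma_{\min}=\mathcal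 M$ if $k\le e$; $\gamma_{\min}=f_0(0)$ if $e<k$ and $e\mid k$; and $\gamma_{\min}=\frac{d\mathcal M}{(\eta+1)d-e\binom{\eta+1}{2}}$ if $e<k$ and $e\nmid k$. **Theorem.** There is a threshold function $\alpha^*(\gamma)=\alpha^*(\mathcal M,n,k,d,e,\gamma)$, defined for $\gamma\ge\gamma_{\min}$, such that for every $\gamma\ge\gamma_{\min}$: * if $\alpha\ge\alpha^*(\gamma)$, then codes exist for $(\mathcal M,\alpha,\gamma/d)$ and every $T$; moreover, if $\alpha>\alpha^*(\gamma)$ or $\alpha/\beta\in\mathbb Q$, then for every $T$ there is such a code with file size at least $\mathcal M$ itself; * if $\alpha<\alpha^*(\gamma)$, then codes do not exist for $(\mathcal M,\alpha,\gamma/d)$ and any $T\ge\lceil k/e\rceil$. It is given by: * if $k\le e$: $\alpha^*=\frac{\mathcal M}{k}$ for $\gamma\in[\mathcal M,\infty)$; * if $k=\eta e$, $\eta\ge2$: $\alpha^*=\frac{\mathcal M}{k}$ for $\gamma\in[f_0(\eta-1),\infty)$, and $\alpha^*=\frac{\mathcal M-\gamma g_0(i)}{ie}$ for $\gamma\in[f_0(i-1),f_0(i)]$,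 $i=\eta-1,\dots,1$; * if $k=\eta e+r$, $\eta\ge1$, $1\le r\le e-1$: $\alpha^*=\frac{\mathcal M}{k}$ for $\gamma\in[f_r(\eta-1),\infty)$; $\alpha^*=\frac{\mathcal M-\gamma g_r(i)}{r+ie}$ for $\gamma\in[f_r(i-1),f_r(i)]$, $i=\eta-1,\dots,1$; and $\alpha^*=\frac{\mathcal M-\gamma g_r(0)}{r}$ for $\gamma\in\left[\frac{d\mathcal M}{(\eta+1)d-e\binom{\eta+1}{2}},f_r(0)\right]$. If $\gamma<\gamma_{\min}$, then codes exist for no $\alpha$ and no $T\ge\lceil k/e\rceil$. For every $T\ge\lceil k/e\rceil$, consider the minimum storage point (MSMR: least possible $\alpha$, and then least $\gamma$ for this $\alpha$) and the minimum bandwidth point (MBMR: least possible $\gamma$, and then least $\alpha$ for this $\gamma$). If $k\le e$, both are $(\alpha,\gamma)=(\mathcal M/k,\mathcal M)$. If $e<k$, then $$(\alpha_{\rm MSMR},\gamma_{\rm MSMR})=\left(\frac{\mathcal M}{k},\ \frac{\mathcal M\,e\,d}{k(d-k+e)}\right),$$ and the MBMR point is given by $$\gamma_{\rm MBMR}=\frac{2ed\mathcal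 M}{-k^2+ek+2kd}=\frac{d\mathcal M}{d\eta-e\binom{\eta}{2}},\qquad \alpha_{\rm MBMR}=\frac{\gamma_{\rm MBMR}}{e}\qquad\text{if } e\mid k,$$ $$\gamma_{\rm MBMR}=\frac{2ed\mathcal M}{(k-r+e)(2d-k+r)}=\frac{d\mathcal M}{d(\eta+1)-e\binom{\eta+1}{2}},\qquad \alpha_{\rm MBMR}=\gamma_{\rm MBMR}\,\frac{d+\eta r-e\eta}{rd}\qquad\text{if } e\nmid k.$$ -/

import Mathlib

/-- One centralized repair: the set of `e` failed nodes (whose places are taken by the `e`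
replacement nodes) and the set of `d` helpers, chosen among the `n - e` available nodes. -/
structure RepairEvent (n d e : ℕ) where
  failed : Finset (Fin n)
  helpers : Finset (Fin n)
  card_failed : failed.card = e
  card_helpers : helpers.card = d
  disj : Disjoint failed helpers

/-- A finite sequence of repairs, the most recent one first. -/
abbrev RepairHistory (n d e : ℕ) : Type := List (RepairEvent n d e)

/-- A functional-repair storage code: `F` is the set of possible files, `A` the set of possible
contents of a node, `B` the set of possible messages of a helper to the central node.
All maps may depend on the repairs made so far and on the current repair (functional repair), but
not on future ones; a helper computes its message from its own current content, and the central node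
computes the contents of the replacement nodes from the messages of the helpers. -/
structure StorageCode (n d e : ℕ) (F A B : Type) where
  encode : F → Fin n → A
  send : RepairHistory n d e → RepairEvent n d e → Fin n → A → B
  regenerate : RepairHistory n d e → (ev : RepairEvent n d e) → (ev.helpers → B) → (ev.failed → A)

namespace StorageCode

variable {n d e : ℕ} {F A B : Type}

/-- The contents of the `n` nodes after the repairs of a history, when the file is `x`. -/
def content (C : StorageCode n d e F A B) : RepairHistory n d e → F → Fin n → A
  | [], x => C.encode x
  | ev :: h, x => fun i =>
      if hi : i ∈ ev.failed then
        C.regenerate h ev (fun j => C.send h ev j (C.content h x j)) ⟨i, hi⟩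
      else C.content h x i

/-- After every sequence of at most `T` repairs, the file can be reconstructed from the
contents of any `k` nodes. -/
def Reconstructs (C : StorageCode n d e F A B) (k T : ℕ) : Prop :=
  ∀ h : RepairHistory n d e, h.length ≤ T → ∀ S : Finset (Fin n), S.card = k →
    ∃ decode : (S → A) → F, ∀ x : F, decode (fun i => C.content h x i) = x

end StorageCode

/-- There is a centralized multi-node repair code that withstands every sequence of at most `T`
repairs, stores a file of `M` units of information, with at most `α` units in each node and at most
`β` units downloaded from each helper. The unit of information (`ℓ` nats) is arbitrary. -/
def HasCode (n k d e T : ℕ) (M α β : ℝ) : Prop :=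
  ∃ (F A B : Type) (_ : Fintype F) (_ : Fintype A) (_ : Fintype B)
    (C : StorageCode n d e F A B) (ℓ : ℝ),
    0 < ℓ ∧
    M * ℓ ≤ Real.log (Fintype.card F) ∧
    Real.log (Fintype.card A) ≤ α * ℓ ∧
    Real.log (Fintype.card B) ≤ β * ℓ ∧
    C.Reconstructs k T

/-- `(M, α, β)` is achievable by codes withstanding `T` repairs: every file size below `M` is
realized by a code. (For real-valued amounts of information, as opposed to integer numbers of
symbols, achievability is meant in the limit, as for the capacity of a network.) -/
def CodesExist (n k d e T : ℕ) (M α β : ℝ) : Prop :=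
  ∀ M' : ℝ, M' < M → HasCode n k d e T M' α β

/-- The breakpoints `f_r(i)`. -/
noncomputable def breakpoint (M : ℝ) (k d e r i : ℕ) : ℝ :=
  2 * e * d * M /
    (-(k : ℝ) ^ 2 - (r : ℝ) ^ 2 + e * ((k : ℝ) - r) + 2 * k * d
      - (e : ℝ) ^ 2 * ((i : ℝ) ^ 2 + i) - 2 * i * e * r)

/-- The offsets `g_r(i)`, with `η = ⌊k / e⌋`. -/
noncomputable def offset (k d e r i : ℕ) : ℝ :=
  (((k / e : ℕ) : ℝ) - i) *
    (-2 * (r : ℝ) + e + 2 * d - ((k / e : ℕ) : ℝ) * e - (e : ℝ) * i) / (2 * d)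

/-- The left end of the range of total bandwidths `γ` on which the threshold is defined. -/
noncomputable def gammaMin (M : ℝ) (k d e : ℕ) : ℝ :=
  if k ≤ e then M
  else if e ∣ k then breakpoint M k d e 0 0
  else d * M / (((k / e : ℕ) + 1) * d - e * (Nat.choose (k / e + 1) 2 : ℝ))

/-- `(α, γ)` is the minimum storage point: `α` is the least possible storage per node, and `γ` is
the least total bandwidth `γ = d β` that is possible with this storage. -/
def IsMSMR (n k d e T : ℕ) (M α γ : ℝ) : Prop :=
  IsLeast {a : ℝ | ∃ c : ℝ, CodesExist n k d e T M a (c / d)} α ∧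
  IsLeast {c : ℝ | CodesExist n k d e T M α (c / d)} γ

/-- `(α, γ)` is the minimum bandwidth point: `γ` is the least possible total bandwidth, and `α` is
the least storage per node that is possible with this bandwidth. -/
def IsMBMR (n k d e T : ℕ) (M α γ : ℝ) : Prop :=
  IsLeast {c : ℝ | ∃ a : ℝ, CodesExist n k d e T M a (c / d)} γ ∧
  IsLeast {a : ℝ | CodesExist n k d e T M a (γ / d)} α

/-! The theorem is a max-flow min-cut statement for the information flow graph of the repairs,
followed by the minimization of an explicit family of cuts.

Converse: a `CutScheme` of size `k` with `y` storage cuts and `z` download cuts is realized by an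
actual history, after which `k` nodes depend only on `y` contents and `z` messages
(`CutScheme.exists_history`). Counting files gives `M ≤ y α + z β`.

Existence: `historyRank` computes the minimum cut between the source and a set of nodes, one repair
at a time. It is submodular, so integral demands below it form a polymatroid. A linear code is kept
in a state where every demand of total `m` below the rank function picks independent coding vectors.
Each demand after a repair is routed back to a demand before it (`exists_pullback`), so each is
satisfied by some repair coefficients, and over a large field one choice satisfies all of them. The
field size needed depends on `n`, `a`, `m` but not on the history, so a single code withstands every
number of repairs. Every rank that could limit decoding is at least the value of a cut scheme
(`historyRank_ge_cutScheme`).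

Minimization: by exchange arguments the smallest cut schemes are `storageCut j` with `j ≤ k / e`
and, if `e ∤ k`, `downloadCut` (`Feasible.le_of_cutScheme`). The cut free of `α` determines
`gammaMin`. Each other cut is a line bounding `α` below, and the threshold is the maximum of these
lines; convexity of `storageCut` in `j` shows that the breakpoints are the crossings of consecutive
lines. -/

/-! ### Integral polymatroids. -/

/-- A normalized, monotone and submodular set function with values in `ℕ`. -/
structure IsRankFunction {ι : Type*} [DecidableEq ι] (ρ : Finset ι → ℕ) : Prop where
  empty : ρ ∅ = 0
  mono : ∀ S T, S ⊆ T → ρ S ≤ ρ T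
  submod : ∀ S T, ρ (S ∪ T) + ρ (S ∩ T) ≤ ρ S + ρ T

namespace IsRankFunction

variable {ι : Type*} [DecidableEq ι] {ρ : Finset ι → ℕ}

/-- Submodularity makes the union of two tight sets tight, so tight sets around the single elements
can be merged. -/
theorem exists_tight_superset (hρ : IsRankFunction ρ) {x : ι → ℕ}
    (hx : ∀ S, ∑ i ∈ S, x i ≤ ρ S) (A : Finset ι)
    (hA : ∀ j ∈ A, ∃ S, j ∈ S ∧ ∑ i ∈ S, x i = ρ S) :
    ∃ S, A ⊆ S ∧ ∑ i ∈ S, x i = ρ S := by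
  induction A using Finset.induction_on with
  | empty => exact ⟨∅, by simp, by simp [hρ.empty]⟩
  | insert j A _ ih =>
    obtain ⟨S, hAS, hS⟩ := ih fun j hj => hA j (Finset.mem_insert_of_mem hj)
    obtain ⟨U, hjU, hU⟩ := hA j (Finset.mem_insert_self _ _)
    refine ⟨U ∪ S, ?_, ?_⟩
    · intro i hi
      rcases Finset.mem_insert.1 hi with rfl | hi
      · exact Finset.mem_union_left _ hjU
      · exact Finset.mem_union_right _ (hAS hi)
    · have h1 := Finset.sum_union_inter (s₁ := U) (s₂ := S) (f := x)
      have h2 := hρ.submod U S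
      have h3 := hx (U ∪ S)
      have h4 := hx (U ∩ S)
      omega

/-- If no coordinate could grow, all coordinates below their bound would lie in one tight set `S`.
Outside `S` the vector equals `q`, so its total would be `ρ S + q(Sᶜ) ≥ m`. -/
theorem exists_increment [Fintype ι] (hρ : IsRankFunction ρ) {x q : ι → ℕ} {m : ℕ}
    (hx : ∀ S, ∑ i ∈ S, x i ≤ ρ S) (hxq : ∀ i, x i ≤ q i)
    (hm : ∑ i, x i < m) (hcut : ∀ S, m ≤ ρ S + ∑ i ∈ Sᶜ, q i) :
    ∃ j, x j < q j ∧ ∀ S, j ∈ S → ∑ i ∈ S, x i < ρ S := by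
  by_contra! hcon
  obtain ⟨S, hAS, hS⟩ := hρ.exists_tight_superset hx (Finset.univ.filter fun j => x j < q j)
    (fun j hj => by
      obtain ⟨S, hjS, hS⟩ := hcon j (Finset.mem_filter.1 hj).2
      exact ⟨S, hjS, le_antisymm (hx S) hS⟩)
  have h1 : ∑ i ∈ Sᶜ, q i = ∑ i ∈ Sᶜ, x i := by
    refine Finset.sum_congr rfl fun i hi => le_antisymm ?_ (hxq i)
    by_contra! hlt
    exact Finset.mem_compl.1 hi (hAS (by simpa using hlt))
  have h2 := hcut S
  have h3 := Finset.sum_add_sum_compl S x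
  omega

/-- Integral greedy extension in the polymatroid of `ρ`, below the bound `q`. -/
theorem exists_extension [Fintype ι] (hρ : IsRankFunction ρ) {x q : ι → ℕ} {m : ℕ}
    (hx : ∀ S, ∑ i ∈ S, x i ≤ ρ S) (hxq : ∀ i, x i ≤ q i)
    (hm : ∑ i, x i ≤ m) (hcut : ∀ S, m ≤ ρ S + ∑ i ∈ Sᶜ, q i) :
    ∃ z : ι → ℕ, (∀ i, x i ≤ z i) ∧ (∀ i, z i ≤ q i) ∧ (∀ S, ∑ i ∈ S, z i ≤ ρ S) ∧
      ∑ i, z i = m := by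
  obtain ⟨t, ht⟩ := Nat.exists_eq_add_of_le hm
  induction t generalizing x with
  | zero => exact ⟨x, fun _ => le_rfl, hxq, hx, by omega⟩
  | succ t ih =>
    obtain ⟨j, hjq, hj⟩ := hρ.exists_increment hx hxq (by omega) hcut
    have hsum : ∀ S : Finset ι, ∑ i ∈ S, (x i + if j = i then 1 else 0) =
        ∑ i ∈ S, x i + if j ∈ S then 1 else 0 := by
      intro S
      rw [Finset.sum_add_distrib, Finset.sum_ite_eq]
    obtain ⟨z, hz, hz'⟩ := ih (x := fun i => x i + if j = i then 1 else 0)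
      (fun S => by
        rw [hsum]
        split_ifs with h
        · exact hj S h
        · exact hx S)
      (fun i => by
        split_ifs with h
        · subst h; omega
        · exact hxq i)
      (by rw [hsum]; simp; omega) (by rw [hsum]; simp; omega)
    exact ⟨z, fun i => le_trans (Nat.le_add_right _ _) (hz i), hz'⟩

end IsRankFunction

/-! ### How one repair changes minimum cuts and demands. -/

/-- The rank function after a repair in which the nodes of `F`, each of capacity `a`, are replaced
with the help of the nodes of `H`, each of which sends `b` symbols. -/
def repairRank {ι : Type*} [DecidableEq ι] (a b : ℕ) (F H : Finset ι) (ρ : Finset ι → ℕ)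
    (S : Finset ι) : ℕ :=
  min (a * (S ∩ F).card + ρ (S \ F))
    (H.powerset.inf' (Finset.powerset_nonempty H) fun X => b * (H \ X).card + ρ (S \ F ∪ X))

section repairRank

variable {ι : Type*} [DecidableEq ι] {a b : ℕ} {F H : Finset ι} {ρ : Finset ι → ℕ}

theorem repairRank_le_store (S : Finset ι) :
    repairRank a b F H ρ S ≤ a * (S ∩ F).card + ρ (S \ F) :=
  min_le_left _ _

theorem repairRank_le_repair (S : Finset ι) {X : Finset ι} (hX : X ⊆ H) :
    repairRank a b F H ρ S ≤ b * (H \ X).card + ρ (S \ F ∪ X) :=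
  (min_le_right _ _).trans
    (Finset.inf'_le (fun X => b * (H \ X).card + ρ (S \ F ∪ X)) (Finset.mem_powerset.2 hX))

/-- The alternatives are the two sides of a minimum cut on which the central node can lie. On the
source side, each replacement node in `S` is cut at its storage; on the sink side, the helpers in
`X` join the sink side and the others are cut at their downloads. -/
theorem repairRank_eq (a b : ℕ) (F H : Finset ι) (ρ : Finset ι → ℕ) (S : Finset ι) :
    repairRank a b F H ρ S = a * (S ∩ F).card + ρ (S \ F) ∨
      ∃ X ⊆ H, repairRank a b F H ρ S = b * (H \ X).card + ρ (S \ F ∪ X) := by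
  rcases min_choice (a * (S ∩ F).card + ρ (S \ F))
    (H.powerset.inf' (Finset.powerset_nonempty H) fun X => b * (H \ X).card + ρ (S \ F ∪ X))
    with h | h
  · exact Or.inl h
  · obtain ⟨X, hX, hX'⟩ := Finset.exists_mem_eq_inf' (Finset.powerset_nonempty H)
      fun X => b * (H \ X).card + ρ (S \ F ∪ X)
    exact Or.inr ⟨X, Finset.mem_powerset.1 hX, h.trans hX'⟩

/-- The cut for `S` leaves the central node on the source side and the cut for `T` puts it on the
sink side. Hence the union of the sink sides contains it and bounds the rank of `S ∪ T`, while the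
intersection avoids it and bounds the rank of `S ∩ T`. -/
theorem repairRank_submod_mixed (hρ : IsRankFunction ρ) (S T : Finset ι) {X : Finset ι}
    (hX : X ⊆ H) :
    repairRank a b F H ρ (S ∪ T) + repairRank a b F H ρ (S ∩ T) ≤
      (a * (S ∩ F).card + ρ (S \ F)) + (b * (H \ X).card + ρ (T \ F ∪ X)) := by
  have h1 := repairRank_le_repair (a := a) (b := b) (F := F) (ρ := ρ) (S ∪ T) hX
  have h2 := repairRank_le_store (a := a) (b := b) (F := F) (H := H) (ρ := ρ) (S ∩ T)
  have h3 := hρ.submod (S \ F) (T \ F ∪ X)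
  have h4 : S \ F ∪ (T \ F ∪ X) = (S ∪ T) \ F ∪ X := by ext; simp; tauto
  have h5 : ρ ((S ∩ T) \ F) ≤ ρ (S \ F ∩ (T \ F ∪ X)) :=
    hρ.mono _ _ (by intro i; simp; tauto)
  have h6 : a * (S ∩ T ∩ F).card ≤ a * (S ∩ F).card :=
    Nat.mul_le_mul_left _ (Finset.card_le_card (by intro i; simp; tauto))
  rw [h4] at h3
  omega

/-- Optimal cuts for `S` and `T` are uncrossed into cuts for `S ∪ T` and `S ∩ T`; the cases record
the side of the central node. -/
theorem IsRankFunction.repairRank (hρ : IsRankFunction ρ) (a b : ℕ) (F H : Finset ι) :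
    IsRankFunction (repairRank a b F H ρ) where
  empty := by
    have := repairRank_le_store (a := a) (b := b) (F := F) (H := H) (ρ := ρ) ∅
    simp [hρ.empty] at this
    exact this
  mono S T hST := by
    have h0 : S \ F ⊆ T \ F := Finset.sdiff_subset_sdiff hST le_rfl
    rcases repairRank_eq a b F H ρ T with h | ⟨X, hX, h⟩
    · rw [h]
      exact (repairRank_le_store S).trans (add_le_add
        (Nat.mul_le_mul_left _ (Finset.card_le_card (Finset.inter_subset_inter_right hST)))
        (hρ.mono _ _ h0))
    · rw [h]
      exact (repairRank_le_repair S hX).trans (Nat.add_le_add_left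
        (hρ.mono _ _ (Finset.union_subset_union_left h0)) _)
  submod S T := by
    rcases repairRank_eq a b F H ρ S with hS | ⟨X, hX, hS⟩ <;>
      rcases repairRank_eq a b F H ρ T with hT | ⟨Y, hY, hT⟩ <;> rw [hS, hT]
    · have h1 := repairRank_le_store (a := a) (b := b) (F := F) (H := H) (ρ := ρ) (S ∪ T)
      have h2 := repairRank_le_store (a := a) (b := b) (F := F) (H := H) (ρ := ρ) (S ∩ T)
      have h3 := hρ.submod (S \ F) (T \ F)
      have h4 : S \ F ∪ T \ F = (S ∪ T) \ F := by ext; simp; tauto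
      have h5 : S \ F ∩ (T \ F) = (S ∩ T) \ F := by ext; simp; tauto
      have h6 : a * ((S ∪ T) ∩ F).card + a * (S ∩ T ∩ F).card =
          a * (S ∩ F).card + a * (T ∩ F).card := by
        rw [← mul_add, ← mul_add, ← Finset.card_union_add_card_inter (S ∩ F) (T ∩ F),
          ← Finset.union_inter_distrib_right, ← Finset.inter_inter_distrib_right]
      rw [h4, h5] at h3
      omega
    · exact repairRank_submod_mixed hρ S T hY
    · rw [Finset.union_comm, Finset.inter_comm, add_comm (b * _ + _)]
      exact repairRank_submod_mixed hρ T S hX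
    · have h1 := repairRank_le_repair (a := a) (b := b) (F := F) (ρ := ρ) (S ∪ T)
        (Finset.union_subset hX hY)
      have h2 := repairRank_le_repair (a := a) (b := b) (F := F) (ρ := ρ) (S ∩ T)
        (X := X ∩ Y) (Finset.inter_subset_left.trans hX)
      have h3 := hρ.submod (S \ F ∪ X) (T \ F ∪ Y)
      have h4 : S \ F ∪ X ∪ (T \ F ∪ Y) = (S ∪ T) \ F ∪ (X ∪ Y) := by ext; simp; tauto
      have h5 : ρ ((S ∩ T) \ F ∪ X ∩ Y) ≤ ρ ((S \ F ∪ X) ∩ (T \ F ∪ Y)) :=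
        hρ.mono _ _ (by intro i; simp; tauto)
      have h6 : b * (H \ (X ∪ Y)).card + b * (H \ (X ∩ Y)).card =
          b * (H \ X).card + b * (H \ Y).card := by
        rw [← mul_add, ← mul_add, ← Finset.card_union_add_card_inter (H \ X) (H \ Y), add_comm]
        congr 3 <;> (ext; simp; tauto)
      rw [h4] at h3
      omega

theorem repairRank_singleton_le (hρ : IsRankFunction ρ) (ha : ∀ i, ρ {i} ≤ a) (i : ι) :
    repairRank a b F H ρ {i} ≤ a := by
  refine (repairRank_le_store _).trans ?_
  by_cases h : i ∈ F
  · simp [h, Finset.singleton_inter_of_mem, Finset.sdiff_eq_empty_iff_subset.2, hρ.empty]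
  · simp [h, Finset.singleton_inter_of_notMem, Finset.sdiff_eq_self_of_disjoint, ha i]

/-- A demand `p` on the nodes after a repair pulls back to a demand on the nodes before it. -/
theorem exists_pullback [Fintype ι] (hρ : IsRankFunction ρ) (hFH : Disjoint F H) {p : ι → ℕ}
    (hp : ∀ S, ∑ i ∈ S, p i ≤ repairRank a b F H ρ S) :
    ∃ z : ι → ℕ, (∀ i ∉ F, p i ≤ z i) ∧ (∀ i ∈ F, z i = 0) ∧ (∀ i ∈ H, z i ≤ p i + b) ∧
      (∀ i ∉ F, i ∉ H → z i = p i) ∧ (∀ S, ∑ i ∈ S, z i ≤ ρ S) ∧ ∑ i, z i = ∑ i, p i := by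
  have hx : ∀ S, ∑ i ∈ S, (if i ∈ F then 0 else p i) = ∑ i ∈ S \ F, p i := by
    intro S
    rw [Finset.sdiff_eq_filter, Finset.sum_filter]
    exact Finset.sum_congr rfl fun i _ => by by_cases h : i ∈ F <;> simp [h]
  -- Surviving nodes keep their demand, failed nodes lose theirs, and the lost amount is
  -- redistributed over the helpers, at most `b` to each.
  obtain ⟨z, h1, h2, h3, h4⟩ := hρ.exists_extension (x := fun i => if i ∈ F then 0 else p i)
    (q := fun i => (if i ∈ F then 0 else p i) + if i ∈ H then b else 0) (m := ∑ i, p i)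
    (fun S => by
      rw [hx]
      refine (hp _).trans ((repairRank_le_store _).trans ?_)
      have : S \ F ∩ F = ∅ := by ext; simp
      rw [this]
      simpa using hρ.mono (S \ F) S Finset.sdiff_subset)
    (fun i => Nat.le_add_right _ _)
    (Finset.sum_le_sum fun i _ => by split_ifs <;> simp)
    (fun S => by
      rw [Finset.sum_add_distrib, hx, ← Finset.sum_filter, Finset.sum_const, smul_eq_mul]
      -- The cut condition for `S` comes from the demand bound on `F ∪ S`, in the cut whose
      -- sink-side helpers are `S ∩ H`.
      have e1 := hp (F ∪ S)
      have e2 := repairRank_le_repair (a := a) (b := b) (F := F) (ρ := ρ) (F ∪ S)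
        (X := S ∩ H) Finset.inter_subset_right
      have e3 : ρ ((F ∪ S) \ F ∪ S ∩ H) ≤ ρ S := hρ.mono _ _ (by intro i; simp; tauto)
      have e4 : H \ (S ∩ H) = Sᶜ.filter (· ∈ H) := by ext; simp; tauto
      have e5 := Finset.sum_add_sum_compl (F ∪ S) p
      have e6 : (F ∪ S)ᶜ = Sᶜ \ F := by ext; simp; tauto
      rw [e4, mul_comm] at e2
      rw [e6] at e5
      omega)
  refine ⟨z, fun i hi => by simpa [hi] using h1 i, fun i hi => ?_, fun i hi => ?_,
    fun i hi hi' => ?_, h3, h4⟩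
  · have := h2 i
    simp only [hi, if_true, Finset.disjoint_left.1 hFH hi, if_false] at this
    omega
  · simpa [hi, Finset.disjoint_right.1 hFH hi] using h2 i
  · exact le_antisymm (by simpa [hi, hi'] using h2 i) (by simpa [hi] using h1 i)

end repairRank

/-! ### Cuts of the information flow graph of a history. -/

/-- Ways to cut off `s` nodes from the source: `y` nodes are cut at their storage, the others are
produced by `t` repairs and cut at `z` downloads. -/
inductive CutScheme (d e : ℕ) : ℕ → ℕ → ℕ → ℕ → Prop
  | nil : CutScheme d e 0 0 0 0
  | store {s y z t : ℕ} (h : CutScheme d e s y z t) : CutScheme d e (s + 1) (y + 1) z t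
  | repair {s y z t u : ℕ} (h : CutScheme d e s y z t) (hu : u ≤ e) :
      CutScheme d e (s + u) y (z + (d - s)) (t + 1)

theorem CutScheme.store_many {d e s y z t : ℕ} (h : CutScheme d e s y z t) (u : ℕ) :
    CutScheme d e (s + u) (y + u) z t := by
  induction u with
  | zero => exact h
  | succ u ih => exact ih.store

/-- The rank function of the information flow graph of a history of repairs. -/
def historyRank {n d e : ℕ} (a b m : ℕ) : RepairHistory n d e → Finset (Fin n) → ℕ
  | [] => fun S => min m (a * S.card)
  | ev :: h => repairRank a b ev.failed ev.helpers (historyRank a b m h)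

section historyRank

variable {n d e : ℕ} (a b m : ℕ)

theorem isRankFunction_historyRank (h : RepairHistory n d e) :
    IsRankFunction (historyRank a b m h) := by
  induction h with
  | nil =>
    refine ⟨by simp [historyRank], fun S T hST => ?_, fun S T => ?_⟩
    · exact min_le_min le_rfl (Nat.mul_le_mul_left _ (Finset.card_le_card hST))
    · have h1 : a * (S ∪ T).card + a * (S ∩ T).card = a * S.card + a * T.card := by
        rw [← mul_add, ← mul_add, Finset.card_union_add_card_inter]
      have h2 : a * S.card ≤ a * (S ∪ T).card :=
        Nat.mul_le_mul_left _ (Finset.card_le_card Finset.subset_union_left)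
      have h3 : a * T.card ≤ a * (S ∪ T).card :=
        Nat.mul_le_mul_left _ (Finset.card_le_card Finset.subset_union_right)
      simp only [historyRank]
      omega
  | cons ev h ih => exact ih.repairRank a b _ _

theorem historyRank_singleton_le (h : RepairHistory n d e) (i : Fin n) :
    historyRank a b m h {i} ≤ a := by
  induction h generalizing i with
  | nil => simp [historyRank]
  | cons ev h ih =>
    exact repairRank_singleton_le (isRankFunction_historyRank a b m h) ih i

/-- Induction peels off the last repair and appends a matching step to a scheme for the earlier
history. Sizes are truncated at `k`, since only `k` nodes are ever read. -/
theorem historyRank_ge_cutScheme (k : ℕ) (h : RepairHistory n d e) (S : Finset (Fin n)) :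
    m ≤ historyRank a b m h S ∨ ∃ s y z t, CutScheme d e s y z t ∧ min S.card k ≤ s ∧ s ≤ k ∧
      y * a + z * b ≤ historyRank a b m h S := by
  induction h generalizing S with
  | nil =>
    rcases le_total m (a * S.card) with hm | hm
    · exact Or.inl (by simp [historyRank, hm])
    · refine Or.inr ⟨min S.card k, min S.card k, 0, 0, ?_, le_rfl, min_le_right _ _, ?_⟩
      · simpa using (CutScheme.nil (d := d) (e := e)).store_many (min S.card k)
      · simp only [historyRank, min_eq_right hm, zero_mul, add_zero]
        rw [mul_comm]
        exact Nat.mul_le_mul_left _ (min_le_left _ _)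
  | cons ev h ih =>
    simp only [historyRank]
    rcases repairRank_eq a b ev.failed ev.helpers (historyRank a b m h) S with hS | ⟨X, hX, hS⟩
    · rw [hS]
      rcases ih (S \ ev.failed) with hm | ⟨s, y, z, t, hc, h1, h2, h3⟩
      · exact Or.inl (hm.trans (Nat.le_add_left _ _))
      · refine Or.inr ⟨_, _, _, _, hc.store_many (min (S ∩ ev.failed).card (k - s)), ?_, ?_, ?_⟩
        · have := Finset.card_sdiff_add_card_inter S ev.failed
          omega
        · omega
        · have : min (S ∩ ev.failed).card (k - s) * a ≤ a * (S ∩ ev.failed).card := by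
            rw [mul_comm]; exact Nat.mul_le_mul_left _ (min_le_left _ _)
          rw [add_mul]
          omega
    · rw [hS]
      rcases ih (S \ ev.failed ∪ X) with hm | ⟨s, y, z, t, hc, h1, h2, h3⟩
      · exact Or.inl (hm.trans (Nat.le_add_left _ _))
      -- With `k` nodes already cut off, nothing is added. Otherwise `s < k` forces `s` to be at
      -- least the number of nodes in `S \ ev.failed ∪ X`, so at most `s` helpers are in `X` and at
      -- least `d - s` downloads are cut.
      · rcases h2.eq_or_lt with rfl | h2
        · exact Or.inr ⟨_, _, _, _, hc, min_le_right _ _, le_rfl,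
            h3.trans (Nat.le_add_left _ _)⟩
        · refine Or.inr ⟨_, _, _, _, hc.repair (min_le_left e (k - s)), ?_, by omega, ?_⟩
          · have c1 := Finset.card_sdiff_add_card_inter S ev.failed
            have c2 : (S ∩ ev.failed).card ≤ e :=
              (Finset.card_le_card Finset.inter_subset_right).trans ev.card_failed.le
            have c3 : (S \ ev.failed).card ≤ (S \ ev.failed ∪ X).card :=
              Finset.card_le_card Finset.subset_union_left
            omega
          · have c1 : X.card ≤ (S \ ev.failed ∪ X).card :=
              Finset.card_le_card Finset.subset_union_right
            have c2 := Finset.card_sdiff_add_card_eq_card hX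
            have c3 := ev.card_helpers
            have c4 : (d - s) * b ≤ b * (ev.helpers \ X).card := by
              rw [mul_comm]; exact Nat.mul_le_mul_left _ (by omega)
            rw [add_mul]
            omega

end historyRank

/-! ### Linear codes that satisfy all demands. -/

/-- The rows chosen by the demand `p`: the first `p i` rows of each node `i`. -/
abbrev SelectedRow {n : ℕ} (a : ℕ) (p : Fin n → ℕ) : Type :=
  {r : Fin n × Fin a // (r.2 : ℕ) < p r.1}

theorem card_selectedRow {n a : ℕ} {p : Fin n → ℕ} (hp : ∀ i, p i ≤ a) :
    Fintype.card (SelectedRow a p) = ∑ i, p i := by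
  let f : SelectedRow a p ≃ Σ i, Fin (p i) :=
    { toFun := fun r => ⟨r.1.1, ⟨r.1.2, r.2⟩⟩
      invFun := fun r => ⟨(r.1, ⟨r.2, r.2.2.trans_le (hp _)⟩), r.2.2⟩
      left_inv := fun _ => rfl
      right_inv := fun _ => rfl }
  rw [Fintype.card_congr f]
  simp

/-- The coding vectors stored by the nodes satisfy the demand `p`. -/
def Satisfies {K : Type*} [Field K] {n a m : ℕ} (G : Fin n → Fin a → Fin m → K) (p : Fin n → ℕ) :
    Prop :=
  LinearIndependent K fun r : SelectedRow a p => G r.1.1 r.1.2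

/-- The product of the polynomials is nonzero and its degree in each variable is below the field
size, so it cannot vanish everywhere. -/
theorem exists_eval_ne_zero_of_forall {σ ι K : Type*} [Finite σ] [Field K] [Fintype K]
    (s : Finset ι) (P : ι → MvPolynomial σ K) (D : ℕ) (hD : ∀ i ∈ s, (P i).totalDegree ≤ D)
    (hP : ∀ i ∈ s, P i ≠ 0) (hK : s.card * D < Fintype.card K) :
    ∃ c : σ → K, ∀ i ∈ s, MvPolynomial.eval c (P i) ≠ 0 := by
  by_contra! hcon
  refine Finset.prod_ne_zero_iff.2 hP
    (MvPolynomial.eq_zero_of_eval_zero_at_prod_finset (∏ i ∈ s, P i) (fun _ => Finset.univ)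
      (fun i => ?_) fun c _ => ?_)
  · refine ((MvPolynomial.degreeOf_le_totalDegree _ _).trans
      (MvPolynomial.totalDegree_finsetProd _ _)).trans_lt ?_
    refine (Finset.sum_le_card_nsmul _ _ _ hD).trans_lt ?_
    simpa using hK
  · obtain ⟨i, hi, h⟩ := hcon c
    rw [map_prod]
    exact Finset.prod_eq_zero hi h

theorem totalDegree_det_le {σ K : Type*} [Field K] {m D : ℕ}
    (A : Matrix (Fin m) (Fin m) (MvPolynomial σ K)) (hA : ∀ i j, (A i j).totalDegree ≤ D) :
    A.det.totalDegree ≤ m * D := by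
  rw [Matrix.det_apply]
  refine MvPolynomial.totalDegree_finsetSum_le fun τ _ => ?_
  have h : (∏ i, A (τ i) i).totalDegree ≤ m * D :=
    (MvPolynomial.totalDegree_finsetProd _ _).trans
      ((Finset.sum_le_card_nsmul _ _ _ fun i _ => hA _ _).trans (by simp))
  rcases Int.units_eq_one_or (Equiv.Perm.sign τ) with hs | hs
  · simpa [hs] using h
  · simpa [hs, Units.smul_def] using h

/-- If each demand of total `m` is satisfied by some choice of the parameters, then over a large
field one choice satisfies them all. -/
theorem exists_satisfies_of_forall {σ K : Type*} [Finite σ] [Field K] [Fintype K] {n a m D : ℕ}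
    (G : Fin n → Fin a → Fin m → MvPolynomial σ K) (hG : ∀ i l t, (G i l t).totalDegree ≤ D)
    (Q : (Fin n → ℕ) → Prop) (hQa : ∀ p, Q p → ∀ i, p i ≤ a) (hQm : ∀ p, Q p → ∑ i, p i = m)
    (hQ : ∀ p, Q p → ∃ c : σ → K, Satisfies (fun i l t => MvPolynomial.eval c (G i l t)) p)
    (hK : (a + 1) ^ n * (m * D) < Fintype.card K) :
    ∃ c : σ → K, ∀ p, Q p → Satisfies (fun i l t => MvPolynomial.eval c (G i l t)) p := by
  classical
  have hcard : ∀ p, Q p → Nonempty (Fin m ≃ SelectedRow a p) := fun p hp =>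
    ⟨Fintype.equivOfCardEq (by rw [card_selectedRow (hQa p hp), hQm p hp, Fintype.card_fin])⟩
  let E : ∀ p, Q p → (Fin m ≃ SelectedRow a p) := fun p hp => (hcard p hp).some
  let P : (Fin n → ℕ) → MvPolynomial σ K := fun p =>
    if hp : Q p then
      Matrix.det (Matrix.of fun s t => G (E p hp s).1.1 (E p hp s).1.2 t)
    else 1
  -- A demand of total `m` selects a square matrix, so it is satisfied exactly where a determinant
  -- polynomial does not vanish.
  have key : ∀ p, Q p → ∀ c : σ → K,
      Satisfies (fun i l t => MvPolynomial.eval c (G i l t)) p ↔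
        MvPolynomial.eval c (P p) ≠ 0 := by
    intro p hp c
    simp only [P, dif_pos hp]
    rw [RingHom.map_det, ← isUnit_iff_ne_zero, ← Matrix.isUnit_iff_isUnit_det,
      ← Matrix.linearIndependent_rows_iff_isUnit, Satisfies,
      ← linearIndependent_equiv (E p hp)]
    rfl
  let s : Finset (Fin n → ℕ) :=
    (Finset.univ.image fun (f : Fin n → Fin (a + 1)) i => (f i : ℕ)).filter Q
  have hs : ∀ p, p ∈ s ↔ Q p := fun p => by
    simp only [s, Finset.mem_filter, Finset.mem_image, Finset.mem_univ, true_and,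
      and_iff_right_iff_imp]
    exact fun hp => ⟨fun i => ⟨p i, Nat.lt_succ_of_le (hQa p hp i)⟩, rfl⟩
  have hscard : s.card ≤ (a + 1) ^ n :=
    (Finset.card_filter_le _ _).trans (Finset.card_image_le.trans (by simp))
  obtain ⟨c, hc⟩ := exists_eval_ne_zero_of_forall s P (m * D)
    (fun p hp => by
      simp only [P, dif_pos ((hs p).1 hp)]
      exact totalDegree_det_le _ fun i j => hG _ _ _)
    (fun p hp h0 => by
      obtain ⟨c, hc⟩ := hQ p ((hs p).1 hp)
      exact (key p ((hs p).1 hp) c).1 hc (by rw [h0, map_zero]))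
    ((Nat.mul_le_mul_right _ hscard).trans_lt hK)
  exact ⟨c, fun p hp => (key p hp c).2 (hc p ((hs p).2 hp))⟩

/-- The coefficients of a linear repair: those used by the helpers and by the central node. -/
abbrev RepairParam (n a b : ℕ) : Type :=
  (Fin n × Fin b × Fin a) ⊕ (Fin n × Fin a × Fin n × Fin b)

/-- The coding vectors after a linear repair with coefficients `c`. -/
def repairState {R : Type*} [CommRing R] {n a b m : ℕ} (F H : Finset (Fin n))
    (c : RepairParam n a b → R) (G : Fin n → Fin a → Fin m → R) : Fin n → Fin a → Fin m → R :=
  fun i l t =>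
    if i ∈ F then
      ∑ j ∈ H, ∑ β, c (.inr (i, l, j, β)) * ∑ α, c (.inl (j, β, α)) * G j α t
    else G i l t

theorem satisfies_of_embedding {K : Type*} [Field K] {n a m : ℕ}
    {G G' : Fin n → Fin a → Fin m → K} {p z : Fin n → ℕ} (hG : Satisfies G z)
    (φ : SelectedRow a p → SelectedRow a z) (hφ : Function.Injective φ)
    (h : ∀ r : SelectedRow a p, G' r.1.1 r.1.2 = G (φ r).1.1 (φ r).1.2) : Satisfies G' p := by
  have := LinearIndependent.comp hG φ hφ
  unfold Satisfies
  convert this using 2 with r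
  exact h r

/-- A repair can route the demand `z` before it to the demand `p` after it. -/
theorem exists_repairState_satisfies {K : Type*} [Field K] {n a b m : ℕ} {F H : Finset (Fin n)}
    {p z : Fin n → ℕ} (hpa : ∀ i, p i ≤ a) (hza : ∀ i, z i ≤ a)
    (h1 : ∀ i ∉ F, p i ≤ z i) (h2 : ∀ i ∈ F, z i = 0) (h3 : ∀ i ∈ H, z i ≤ p i + b)
    (h4 : ∀ i ∉ F, i ∉ H → z i = p i) (hsum : ∑ i, z i = ∑ i, p i)
    {G : Fin n → Fin a → Fin m → K} (hG : Satisfies G z) :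
    ∃ c : RepairParam n a b → K, Satisfies (repairState F H c G) p := by
  classical
  let old : Finset (SelectedRow a z) := Finset.univ.filter fun r => p r.1.1 ≤ r.1.2
  let new : Finset (SelectedRow a p) := Finset.univ.filter fun r => r.1.1 ∈ F
  have hcard : new.card ≤ old.card := by
    -- Both complements consist of the rows on surviving nodes with index below `p`. As the totals
    -- agree, the rows demanded on failed nodes are as many as the surplus rows of `z`.
    have e1 : newᶜ.card = oldᶜ.card := by
      refine Finset.card_bij (fun r hr => ⟨r.1, r.2.trans_le (h1 _ (by simpa [new] using hr))⟩)
        (fun r hr => ?_) (fun r _ s _ h => ?_) (fun r hr => ?_)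
      · simpa [old] using r.2
      · exact Subtype.ext (congrArg (fun x : SelectedRow a z => x.1) h)
      · refine ⟨⟨r.1, by simpa [old] using hr⟩, ?_, rfl⟩
        have hr2 := r.2
        simp only [new, Finset.compl_filter, Finset.mem_filter, Finset.mem_univ, true_and]
        intro hF
        rw [h2 _ hF] at hr2
        omega
    have e2 := Finset.card_add_card_compl new
    have e3 := Finset.card_add_card_compl old
    rw [card_selectedRow hpa] at e2
    rw [card_selectedRow hza] at e3
    omega
  obtain ⟨g⟩ : Nonempty (new ↪ old) :=
    Function.Embedding.nonempty_of_card_le (by simpa using hcard)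
  let φ : SelectedRow a p → SelectedRow a z := fun r =>
    if hr : r.1.1 ∈ F then (g ⟨r, by simpa [new] using hr⟩).1
    else ⟨r.1, r.2.trans_le (h1 _ hr)⟩
  have hgF : ∀ r : SelectedRow a p, ∀ hr : r.1.1 ∈ F, p (φ r).1.1 ≤ (φ r).1.2 := by
    intro r hr
    have := (g ⟨r, by simpa [new] using hr⟩).2
    simp only [φ, dif_pos hr]
    exact (Finset.mem_filter.1 this).2
  have hgF' : ∀ r : SelectedRow a p, r.1.1 ∉ F → (φ r).1 = r.1 := by
    intro r hr
    simp [φ, hr]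
  have hφ : Function.Injective φ := by
    intro r s hrs
    by_cases hr : r.1.1 ∈ F <;> by_cases hs : s.1.1 ∈ F
    · have : g ⟨r, by simpa [new] using hr⟩ = g ⟨s, by simpa [new] using hs⟩ :=
        Subtype.ext (by simpa [φ, hr, hs] using hrs)
      simpa using g.injective this
    · have e1 := hgF r hr
      rw [hrs, hgF' s hs] at e1
      exact absurd s.2 (not_lt.2 e1)
    · have e1 := hgF s hs
      rw [← hrs, hgF' r hr] at e1
      exact absurd r.2 (not_lt.2 e1)
    · exact Subtype.ext (by rw [← hgF' r hr, hrs, hgF' s hs])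
  -- Helper `j` sends its rows `p j, …, p j + b - 1`, which cover its surplus because `z j ≤ p j +
  -- b`. The central node copies to each new row the surplus row assigned by `φ`.
  let c : RepairParam n a b → K := Sum.elim
    (fun x => if (x.2.2 : ℕ) = p x.1 + x.2.1 then 1 else 0)
    (fun x => if hx : (x.2.1 : ℕ) < p x.1 then
      (if (φ ⟨(x.1, x.2.1), hx⟩).1.1 = x.2.2.1 ∧
        ((φ ⟨(x.1, x.2.1), hx⟩).1.2 : ℕ) = p x.2.2.1 + x.2.2.2 then 1 else 0) else 0)
  refine ⟨c, satisfies_of_embedding hG φ hφ fun r => ?_⟩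
  funext t
  obtain ⟨⟨i, l⟩, hl⟩ := r
  by_cases hi : i ∈ F
  · have hlo := hgF ⟨(i, l), hl⟩ hi
    set y := φ ⟨(i, l), hl⟩ with hy
    have hyz := y.2
    have hyF : y.1.1 ∉ F := fun h => by rw [h2 _ h] at hyz; omega
    have hyH : y.1.1 ∈ H := by
      by_contra h
      rw [h4 _ hyF h] at hyz
      omega
    have hyb := h3 _ hyH
    simp only [repairState, hi, if_true]
    rw [Finset.sum_eq_single_of_mem y.1.1 hyH,
      Finset.sum_eq_single_of_mem (⟨y.1.2 - p y.1.1, by omega⟩ : Fin b) (Finset.mem_univ _),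
      Finset.sum_eq_single_of_mem y.1.2 (Finset.mem_univ _)]
    · have e1 : (y.1.2 : ℕ) = p y.1.1 + (y.1.2 - p y.1.1) := by omega
      simp only [c, Sum.elim_inl, Sum.elim_inr, dif_pos hl, ← hy]
      rw [if_pos ⟨trivial, e1⟩, if_pos e1, one_mul, one_mul]
    · intro α _ hα
      simp only [c, Sum.elim_inl]
      rw [if_neg, zero_mul]
      intro h
      exact hα (Fin.ext (by omega))
    · intro β _ hβ
      simp only [c, Sum.elim_inr, dif_pos hl, ← hy]
      rw [if_neg, zero_mul]
      rintro ⟨-, h⟩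
      exact hβ (Fin.ext (by simp only; omega))
    · intro j _ hj
      refine Finset.sum_eq_zero fun β _ => ?_
      simp only [c, Sum.elim_inr, dif_pos hl, ← hy]
      rw [if_neg, zero_mul]
      rintro ⟨h, -⟩
      exact hj h.symm
  · rw [hgF' ⟨(i, l), hl⟩ hi]
    simp [repairState, hi]

/-- All demands that respect the rank function `ρ` and have total `m` are satisfied. -/
def SatisfiesAll {K : Type*} [Field K] {n a m : ℕ} (ρ : Finset (Fin n) → ℕ)
    (G : Fin n → Fin a → Fin m → K) : Prop :=
  ∀ p : Fin n → ℕ, (∀ S, ∑ i ∈ S, p i ≤ ρ S) → ∑ i, p i = m → Satisfies G p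

/-- All coordinates of the coding vectors are free variables, and distinct unit vectors satisfy any
single demand. -/
theorem exists_initial_satisfiesAll {K : Type*} [Field K] [Fintype K] {n a m : ℕ}
    {ρ : Finset (Fin n) → ℕ} (ha : ∀ i, ρ {i} ≤ a)
    (hK : (a + 1) ^ n * (m * 1) < Fintype.card K) :
    ∃ G : Fin n → Fin a → Fin m → K, SatisfiesAll ρ G := by
  classical
  obtain ⟨c, hc⟩ := exists_satisfies_of_forall (K := K) (n := n) (a := a) (m := m) (D := 1)
    (σ := Fin n × Fin a × Fin m) (fun i l t => MvPolynomial.X (i, l, t))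
    (fun i l t => by simp)
    (fun p => (∀ S, ∑ i ∈ S, p i ≤ ρ S) ∧ ∑ i, p i = m)
    (fun p hp i => by simpa using (hp.1 {i}).trans (ha i))
    (fun p hp => hp.2)
    (fun p hp => by
      have hpa : ∀ i, p i ≤ a := fun i => by simpa using (hp.1 {i}).trans (ha i)
      let E : SelectedRow a p ≃ Fin m :=
        Fintype.equivOfCardEq (by rw [card_selectedRow hpa, hp.2, Fintype.card_fin])
      refine ⟨fun x => if h : (x.2.1 : ℕ) < p x.1 then
        (Pi.single (E ⟨(x.1, x.2.1), h⟩) 1 : Fin m → K) x.2.2 else 0, ?_⟩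
      have := (Pi.linearIndependent_single_one (Fin m) K).comp E E.injective
      unfold Satisfies
      convert this using 2 with r
      funext t
      simp [r.2])
    hK
  exact ⟨_, fun p hp hm => hc p ⟨hp, hm⟩⟩

/-- The state before the repair is a constant, so the new entries have degree at most 2 in the
coefficients of this repair. This keeps the required field size independent of the history. -/
theorem exists_repair_satisfiesAll {K : Type*} [Field K] [Fintype K] {n a b m : ℕ}
    {ρ : Finset (Fin n) → ℕ} (hρ : IsRankFunction ρ) (ha : ∀ i, ρ {i} ≤ a)
    {F H : Finset (Fin n)} (hFH : Disjoint F H) (hK : (a + 1) ^ n * (m * 2) < Fintype.card K)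
    {G : Fin n → Fin a → Fin m → K} (hG : SatisfiesAll ρ G) :
    ∃ c : RepairParam n a b → K,
      SatisfiesAll (repairRank a b F H ρ) (repairState F H c G) := by
  classical
  have heval : ∀ c : RepairParam n a b → K, ∀ i l t,
      MvPolynomial.eval c (repairState F H MvPolynomial.X
        (fun i l t => MvPolynomial.C (G i l t)) i l t) = repairState F H c G i l t := by
    intro c i l t
    by_cases hi : i ∈ F <;> simp [repairState, hi]
  obtain ⟨c, hc⟩ := exists_satisfies_of_forall (K := K) (D := 2)
    (repairState F H (MvPolynomial.X : RepairParam n a b → MvPolynomial _ K)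
      fun i l t => MvPolynomial.C (G i l t))
    (fun i l t => by
      by_cases hi : i ∈ F
      · simp only [repairState, hi, if_true]
        refine MvPolynomial.totalDegree_finsetSum_le fun j _ =>
          MvPolynomial.totalDegree_finsetSum_le fun β _ =>
          (MvPolynomial.totalDegree_mul _ _).trans ?_
        have : (∑ α, MvPolynomial.X (R := K) (Sum.inl (j, β, α) : RepairParam n a b) *
            MvPolynomial.C (G j α t)).totalDegree ≤ 1 :=
          MvPolynomial.totalDegree_finsetSum_le fun α _ =>
            (MvPolynomial.totalDegree_mul _ _).trans (by simp)
        have h1 : (MvPolynomial.X (R := K)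
          (Sum.inr (i, l, j, β) : RepairParam n a b)).totalDegree = 1 := by simp
        omega
      · simp [repairState, hi])
    (fun p => (∀ S, ∑ i ∈ S, p i ≤ repairRank a b F H ρ S) ∧ ∑ i, p i = m)
    (fun p hp i => by simpa using (hp.1 {i}).trans (repairRank_singleton_le hρ ha i))
    (fun p hp => hp.2)
    (fun p hp => by
      obtain ⟨z, h1, h2, h3, h4, h5, h6⟩ := exists_pullback hρ hFH hp.1
      simp only [heval]
      exact exists_repairState_satisfies
        (fun i => by simpa using (hp.1 {i}).trans (repairRank_singleton_le hρ ha i))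
        (fun i => by simpa using (h5 {i}).trans (ha i)) h1 h2 h3 h4 h6
        (hG z h5 (h6.trans hp.2)))
    hK
  simp only [heval] at hc
  exact ⟨c, fun p hp hm => hc p ⟨hp, hm⟩⟩

/-- Linear codes in which every demand allowed by the information flow graph is satisfied after
every history of repairs. -/
theorem exists_states {K : Type*} [Field K] [Fintype K] {n d e : ℕ} (a b m : ℕ)
    (hK : (a + 1) ^ n * (m * 2) < Fintype.card K) :
    ∃ (G : RepairHistory n d e → Fin n → Fin a → Fin m → K)
      (c : RepairHistory n d e → RepairEvent n d e → RepairParam n a b → K),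
      (∀ h, SatisfiesAll (historyRank a b m h) (G h)) ∧
      ∀ ev h, G (ev :: h) = repairState ev.failed ev.helpers (c h ev) (G h) := by
  have hK1 : (a + 1) ^ n * (m * 1) < Fintype.card K :=
    (Nat.mul_le_mul_left _ (Nat.mul_le_mul_left _ (by norm_num))).trans_lt hK
  obtain ⟨G₀, hG₀⟩ := exists_initial_satisfiesAll (K := K)
    (historyRank_singleton_le (n := n) (d := d) (e := e) a b m []) hK1
  have hstep := fun (h : RepairHistory n d e) (ev : RepairEvent n d e)
      (G : {G : Fin n → Fin a → Fin m → K // SatisfiesAll (historyRank a b m h) G}) =>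
    exists_repair_satisfiesAll (b := b) (isRankFunction_historyRank a b m h)
      (historyRank_singleton_le a b m h) ev.disj hK G.2
  choose f hf using hstep
  let st : ∀ h : RepairHistory n d e,
      {G : Fin n → Fin a → Fin m → K // SatisfiesAll (historyRank a b m h) G} := fun h =>
    List.rec (motive := fun h =>
      {G : Fin n → Fin a → Fin m → K // SatisfiesAll (historyRank a b m h) G})
      ⟨G₀, hG₀⟩ (fun ev h G => ⟨_, hf h ev G⟩) h
  exact ⟨fun h => (st h).1, fun h ev => f h ev (st h), fun h => (st h).2, fun ev h => rfl⟩

/-- A demand of total `m` that is supported on a set of rank at least `m`. -/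
theorem exists_demand {ι : Type*} [Fintype ι] [DecidableEq ι] {ρ : Finset ι → ℕ}
    (hρ : IsRankFunction ρ) {m : ℕ} {S : Finset ι} (hS : m ≤ ρ S) :
    ∃ p : ι → ℕ, (∀ i ∉ S, p i = 0) ∧ (∀ U, ∑ i ∈ U, p i ≤ ρ U) ∧ ∑ i, p i = m := by
  -- With bound `m` on `S` and 0 elsewhere, a cut that misses part of `S` already costs `m`.
  obtain ⟨p, -, h2, h3, h4⟩ := hρ.exists_extension (x := fun _ => 0)
    (q := fun i => if i ∈ S then m else 0) (m := m) (by simp) (by simp) (by simp) (fun U => by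
      by_cases hSU : S ⊆ U
      · exact hS.trans ((hρ.mono _ _ hSU).trans (Nat.le_add_right _ _))
      · obtain ⟨i, hiS, hiU⟩ := Finset.not_subset.1 hSU
        have := Finset.single_le_sum (f := fun i => if i ∈ S then m else 0) (s := Uᶜ)
          (fun _ _ => Nat.zero_le _) (Finset.mem_compl.2 hiU)
        simp only [hiS, if_true] at this
        omega)
  exact ⟨p, fun i hi => by simpa [hi] using h2 i, h3, h4⟩

theorem eq_of_satisfies {K : Type*} [Field K] {n a m : ℕ} {G : Fin n → Fin a → Fin m → K}
    {p : Fin n → ℕ} (hpa : ∀ i, p i ≤ a) (hm : ∑ i, p i = m) (hG : Satisfies G p)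
    {x x' : Fin m → K}
    (h : ∀ r : SelectedRow a p, ∑ t, G r.1.1 r.1.2 t * x t = ∑ t, G r.1.1 r.1.2 t * x' t) :
    x = x' := by
  let E : Fin m ≃ SelectedRow a p :=
    Fintype.equivOfCardEq (by rw [card_selectedRow hpa, hm, Fintype.card_fin])
  let A : Matrix (Fin m) (Fin m) K := Matrix.of fun s t => G (E s).1.1 (E s).1.2 t
  have hA : IsUnit A := by
    rw [← Matrix.linearIndependent_rows_iff_isUnit]
    exact (linearIndependent_equiv E).2 hG
  exact Matrix.mulVec_injective_of_isUnit hA (funext fun s => h (E s))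

/-- The linear code with initial coding vectors `G₀` and repair coefficients `c`. -/
def linearCode {K : Type} [Field K] {n d e a b m : ℕ} (G₀ : Fin n → Fin a → Fin m → K)
    (c : RepairHistory n d e → RepairEvent n d e → RepairParam n a b → K) :
    StorageCode n d e (Fin m → K) (Fin a → K) (Fin b → K) where
  encode x i l := ∑ t, G₀ i l t * x t
  send h ev j v β := ∑ α, c h ev (.inl (j, β, α)) * v α
  regenerate h ev w i l := ∑ j : ev.helpers, ∑ β, c h ev (.inr (i, l, j, β)) * w j β

theorem linearCode_content {K : Type} [Field K] {n d e a b m : ℕ}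
    {G : RepairHistory n d e → Fin n → Fin a → Fin m → K}
    (c : RepairHistory n d e → RepairEvent n d e → RepairParam n a b → K)
    (hG : ∀ ev h, G (ev :: h) = repairState ev.failed ev.helpers (c h ev) (G h))
    (h : RepairHistory n d e) (x : Fin m → K) (i : Fin n) (l : Fin a) :
    (linearCode (G []) c).content h x i l = ∑ t, G h i l t * x t := by
  induction h generalizing i l with
  | nil => rfl
  | cons ev h ih =>
    rw [hG]
    by_cases hi : i ∈ ev.failed
    · have hsum : (linearCode (G []) c).content (ev :: h) x i l = ∑ j ∈ ev.helpers, ∑ β,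
          c h ev (.inr (i, l, j, β)) *
            ∑ α, c h ev (.inl (j, β, α)) * (linearCode (G []) c).content h x j α := by
        simp only [StorageCode.content, dif_pos hi]
        exact Finset.sum_coe_sort ev.helpers fun j => ∑ β, c h ev (.inr (i, l, j, β)) *
          ∑ α, c h ev (.inl (j, β, α)) * (linearCode (G []) c).content h x j α
      rw [hsum]
      simp only [repairState, if_pos hi, ih, Finset.sum_mul]
      conv_rhs => rw [Finset.sum_comm]
      refine Finset.sum_congr rfl fun j _ => ?_
      conv_rhs => rw [Finset.sum_comm]
      refine Finset.sum_congr rfl fun β _ => ?_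
      simp only [mul_assoc, ← Finset.mul_sum]
      congr 1
      simp only [Finset.sum_mul, Finset.mul_sum, mul_assoc]
      rw [Finset.sum_comm]
    · simp only [StorageCode.content, dif_neg hi, repairState, if_neg hi]
      exact ih i l

/-- The hypothesis makes the rank of any `k` nodes at least `m`, so a demand of total `m` is
supported on them, and the independent rows it selects determine the file. -/
theorem exists_code_of_forall_cutScheme {n k d e a b m : ℕ}
    (hcut : ∀ y z t, CutScheme d e k y z t → m ≤ y * a + z * b) :
    ∃ (K : Type) (_ : Fintype K) (C : StorageCode n d e (Fin m → K) (Fin a → K) (Fin b → K)),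
      2 ≤ Fintype.card K ∧ ∀ T, C.Reconstructs k T := by
  classical
  set N := (a + 1) ^ n * (m * 2) + 1 with hN
  have : Fact (Nat.Prime 2) := ⟨Nat.prime_two⟩
  let K := GaloisField 2 N
  have : Fintype K := Fintype.ofFinite K
  have hKcard : Fintype.card K = 2 ^ N := by
    rw [← Nat.card_eq_fintype_card, GaloisField.card 2 N (by omega)]
  have hK : (a + 1) ^ n * (m * 2) < Fintype.card K := by
    rw [hKcard]
    exact (Nat.lt_succ_self _).trans Nat.lt_two_pow_self
  obtain ⟨G, c, hG, hGc⟩ := exists_states (n := n) (d := d) (e := e) a b m hK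
  have hC := linearCode_content c hGc
  refine ⟨K, inferInstance, linearCode (G []) c, ?_, fun T h _ S hS => ?_⟩
  · rw [hKcard]
    exact Nat.le_self_pow (by omega) 2
  · have hrank : m ≤ historyRank a b m h S := by
      rcases historyRank_ge_cutScheme a b m k h S with hm | ⟨s, y, z, t, hs, h1, h2, h3⟩
      · exact hm
      · obtain rfl : s = k := by omega
        exact (hcut y z t hs).trans h3
    obtain ⟨p, hp0, hp1, hp2⟩ := exists_demand (isRankFunction_historyRank a b m h) hrank
    have hinj : Function.Injective fun (x : Fin m → K) (i : S) =>
        (linearCode (G []) c).content h x i := by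
      intro x x' hxx
      refine eq_of_satisfies (fun i => ?_) hp2 (hG h p hp1 hp2) fun r => ?_
      · simpa using (hp1 {i}).trans (historyRank_singleton_le a b m h i)
      · have hrS : r.1.1 ∈ S := by
          by_contra hr
          have := r.2
          rw [hp0 _ hr] at this
          omega
        rw [← hC, ← hC]
        exact congrFun (congrFun hxx ⟨r.1.1, hrS⟩) r.1.2
    exact ⟨Function.invFun _, Function.leftInverse_invFun hinj⟩

/-! ### The converse bound from cuts. -/

/-- Every cut scheme is realized by a history of repairs: some `s` nodes are then determined by `y`
node contents and `z` messages. -/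
theorem CutScheme.exists_history {n d e : ℕ} {F A B : Type} (C : StorageCode n d e F A B)
    (hdn : d + e ≤ n) {s y z t : ℕ} (h : CutScheme d e s y z t) (hs : s ≤ d) :
    ∃ (h : RepairHistory n d e) (S : Finset (Fin n)) (g : F → Fin y → A) (g' : F → Fin z → B),
      h.length = t ∧ S.card = s ∧ ∀ x x', g x = g x' → g' x = g' x' →
        ∀ i ∈ S, C.content h x i = C.content h x' i := by
  induction h with
  | nil => exact ⟨[], ∅, fun _ => Fin.elim0, fun _ => Fin.elim0, rfl, rfl, by simp⟩
  | @store s y z t _ ih =>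
    obtain ⟨h, S, g, g', hl, hS, hg⟩ := ih (by omega)
    obtain ⟨i, hi⟩ : ∃ i, i ∉ S := by
      by_contra! hcon
      have := Finset.card_le_card (fun i _ => hcon i : (Finset.univ : Finset (Fin n)) ⊆ S)
      rw [Finset.card_univ, Fintype.card_fin] at this
      omega
    refine ⟨h, insert i S, fun x => Fin.cons (C.content h x i) (g x), g', hl,
      by rw [Finset.card_insert_of_notMem hi, hS], fun x x' h1 h2 j hj => ?_⟩
    obtain ⟨h3, h4⟩ := Fin.cons_inj.1 h1
    rcases Finset.mem_insert.1 hj with rfl | hj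
    · exact h3
    · exact hg x x' h4 h2 j hj
  | @repair s y z t u _ hu ih =>
    obtain ⟨h, S, g, g', hl, hS, hg⟩ := ih (by omega)
    -- The failed nodes avoid `S`, so `S` stays determined, and the helpers include all of `S`, so
    -- only `d - s` messages are new.
    obtain ⟨E, hES, hE⟩ : ∃ E ⊆ Sᶜ, E.card = e := Finset.exists_subset_card_eq (by
      rw [Finset.card_compl, Fintype.card_fin]; omega)
    obtain ⟨H, hSH, hHE, hH⟩ : ∃ H, S ⊆ H ∧ H ⊆ Eᶜ ∧ H.card = d :=
      Finset.exists_subsuperset_card_eq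
        (fun i hi => Finset.mem_compl.2 fun hiE => Finset.mem_compl.1 (hES hiE) hi)
        (by omega) (by rw [Finset.card_compl, Fintype.card_fin]; omega)
    obtain ⟨U, hUE, hU⟩ : ∃ U ⊆ E, U.card = u := Finset.exists_subset_card_eq (by omega)
    have hdisj : Disjoint E H :=
      Finset.disjoint_left.2 fun i hi hiH => Finset.mem_compl.1 (hHE hiH) hi
    let ev : RepairEvent n d e := ⟨E, H, hE, hH, hdisj⟩
    have hcard : (H \ S).card = d - s := by rw [Finset.card_sdiff_of_subset hSH, hH, hS]
    let w : F → Fin (d - s) → B := fun x j =>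
      C.send h ev ((H \ S).equivFinOfCardEq hcard |>.symm j)
        (C.content h x ((H \ S).equivFinOfCardEq hcard |>.symm j))
    refine ⟨ev :: h, S ∪ U, g, fun x => Fin.append (g' x) (w x), by simp [hl], ?_,
      fun x x' h1 h2 i hi => ?_⟩
    · rw [Finset.card_union_of_disjoint, hS, hU]
      exact Finset.disjoint_left.2 fun i hi hiU => Finset.mem_compl.1 (hES (hUE hiU)) hi
    · have h3 : g' x = g' x' := funext fun j => by
        simpa using congrFun h2 (Fin.castAdd _ j)
      have h4 : w x = w x' := funext fun j => by
        simpa using congrFun h2 (Fin.natAdd _ j)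
      have hsend : ∀ j ∈ H, C.send h ev j (C.content h x j) = C.send h ev j (C.content h x' j) := by
        intro j hj
        by_cases hjS : j ∈ S
        · rw [hg x x' h1 h3 j hjS]
        · simpa [w] using congrFun h4
            ((H \ S).equivFinOfCardEq hcard ⟨j, Finset.mem_sdiff.2 ⟨hj, hjS⟩⟩)
      by_cases hiE : i ∈ ev.failed
      · simp only [StorageCode.content, dif_pos hiE]
        exact congrFun (congrArg (C.regenerate h ev) (funext fun j => hsend j j.2)) ⟨i, hiE⟩
      · simp only [StorageCode.content, dif_neg hiE]
        refine hg x x' h1 h3 i ?_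
        rcases Finset.mem_union.1 hi with hi | hi
        · exact hi
        · exact absurd (hUE hi) hiE

/-- The `y` contents and `z` messages determine the file by decoding, so there are at most `|A| ^ y
* |B| ^ z` files. -/
theorem HasCode.le_of_cutScheme {n k d e T : ℕ} {M α β : ℝ} (hC : HasCode n k d e T M α β)
    (hM : 0 < M) (hkd : k ≤ d) (hdn : d + e ≤ n) {y z t : ℕ} (h : CutScheme d e k y z t)
    (ht : t ≤ T) : M ≤ y * α + z * β := by
  obtain ⟨F, A, B, hF, hA, hB, C, ℓ, hℓ, h1, h2, h3, hrec⟩ := hC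
  obtain ⟨h, S, g, g', hl, hS, hg⟩ := h.exists_history C hdn hkd
  obtain ⟨decode, hdec⟩ := hrec h (hl.le.trans ht) S hS
  have hinj : Function.Injective fun x => (g x, g' x) := by
    intro x x' hx
    obtain ⟨e1, e2⟩ := Prod.mk.inj hx
    rw [← hdec x, ← hdec x']
    exact congrArg decode (funext fun i => hg x x' e1 e2 i i.2)
  have hcard : Fintype.card F ≤ Fintype.card A ^ y * Fintype.card B ^ z := by
    classical
    simpa using Fintype.card_le_of_injective _ hinj
  have hF0 : 0 < Real.log (Fintype.card F) := (mul_pos hM hℓ).trans_le h1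
  have hF1 : (0 : ℝ) < Fintype.card F := by
    rcases (Nat.cast_nonneg (Fintype.card F) : (0 : ℝ) ≤ _).eq_or_lt with h0 | h0
    · rw [← h0, Real.log_zero] at hF0
      exact absurd hF0 (lt_irrefl _)
    · exact h0
  have hcard' : (Fintype.card F : ℝ) ≤ (Fintype.card A : ℝ) ^ y * (Fintype.card B : ℝ) ^ z := by
    exact_mod_cast hcard
  have hne := (hF1.trans_le hcard').ne'
  have hlog := Real.log_le_log hF1 hcard'
  rw [Real.log_mul (left_ne_zero_of_mul hne) (right_ne_zero_of_mul hne), Real.log_pow,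
    Real.log_pow] at hlog
  have h4 := mul_le_mul_of_nonneg_left h2 (Nat.cast_nonneg (α := ℝ) y)
  have h5 := mul_le_mul_of_nonneg_left h3 (Nat.cast_nonneg (α := ℝ) z)
  refine le_of_mul_le_mul_right ?_ hℓ
  linarith

theorem CodesExist.le_of_cutScheme {n k d e T : ℕ} {M α β : ℝ}
    (hC : CodesExist n k d e T M α β) (hM : 0 < M) (hkd : k ≤ d) (hdn : d + e ≤ n) {y z t : ℕ}
    (h : CutScheme d e k y z t) (ht : t ≤ T) : M ≤ y * α + z * β := by
  refine le_of_forall_lt_imp_le_of_dense fun M' hM' => ?_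
  -- The maximum with `M / 2` keeps the file size positive, as the bound for a single code requires.
  exact (le_max_left _ _).trans
    ((hC (max M' (M / 2)) (max_lt hM' (by linarith))).le_of_cutScheme
      (lt_max_of_lt_right (by linarith)) hkd hdn h ht)

/-! ### From numbers of symbols to real amounts of information. -/

theorem HasCode.mono {n k d e T : ℕ} {M M' α α' β : ℝ} (hC : HasCode n k d e T M α β)
    (hM : M' ≤ M) (hα : α ≤ α') : HasCode n k d e T M' α' β := by
  obtain ⟨F, A, B, hF, hA, hB, C, ℓ, hℓ, h1, h2, h3, hrec⟩ := hC
  exact ⟨F, A, B, hF, hA, hB, C, ℓ, hℓ, (mul_le_mul_of_nonneg_right hM hℓ.le).trans h1,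
    h2.trans (mul_le_mul_of_nonneg_right hα hℓ.le), h3, hrec⟩

/-- Cut values in symbols are integers, so rounding the file size up to `⌈M * b / β⌉₊` costs
nothing. This is why a rational ratio attains `M` itself. The unit is fixed by `b` symbols being
worth `β`. -/
theorem hasCode_of_forall_cutScheme {n k d e : ℕ} {M β : ℝ} (hβ : 0 < β) (a b : ℕ) (hb : 0 < b)
    (hcut : ∀ y z t, CutScheme d e k y z t → M ≤ y * (a / b * β) + z * β) (T : ℕ) :
    HasCode n k d e T M (a / b * β) β := by
  have hb' : (0 : ℝ) < b := by exact_mod_cast hb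
  obtain ⟨K, hK, C, hK2, hC⟩ := exists_code_of_forall_cutScheme (n := n) (k := k) (d := d)
    (e := e) (a := a) (b := b) (m := ⌈M * b / β⌉₊) (fun y z t h => by
      refine Nat.ceil_le.2 ?_
      rw [div_le_iff₀ hβ]
      have := mul_le_mul_of_nonneg_right (hcut y z t h) hb'.le
      refine this.trans (le_of_eq ?_)
      push_cast
      field_simp)
  have hlog : 0 < Real.log (Fintype.card K) := Real.log_pos (by exact_mod_cast hK2)
  classical
  refine ⟨_, _, _, inferInstance, inferInstance, inferInstance, C,
    Real.log (Fintype.card K) * b / β, by positivity, ?_, ?_, ?_, hC T⟩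
  · rw [Fintype.card_fun, Fintype.card_fin, Nat.cast_pow, Real.log_pow]
    have := mul_le_mul_of_nonneg_right (Nat.le_ceil (M * b / β)) hlog.le
    refine (le_of_eq ?_).trans this
    field_simp
  · rw [Fintype.card_fun, Fintype.card_fin, Nat.cast_pow, Real.log_pow]
    refine le_of_eq ?_
    field_simp
  · rw [Fintype.card_fun, Fintype.card_fin, Nat.cast_pow, Real.log_pow]
    refine le_of_eq ?_
    field_simp

/-! ### The smallest cuts. -/

/-- The value of the cut in which `k - j e` nodes are cut at their storage, and `j` successive
repairs of `e` nodes each are cut at their downloads. -/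
noncomputable def storageCut (k d e : ℕ) (j : ℕ) (α β : ℝ) : ℝ :=
  ((k : ℝ) - j * e) * α + (j * ((d : ℝ) - k) + e * j * (j + 1) / 2) * β

/-- The value of the cut in which all `k` nodes are cut at the downloads of their repairs. -/
noncomputable def downloadCut (k d e : ℕ) (β : ℝ) : ℝ :=
  (((k / e : ℕ) + 1) * (d : ℝ) - e * (k / e : ℕ) * ((k / e : ℕ) + 1) / 2) * β

/-- No cut of the information flow graphs is smaller than `M`. -/
structure Feasible (M : ℝ) (k d e : ℕ) (α β : ℝ) : Prop where
  storage : ∀ j ≤ k / e, M ≤ storageCut k d e j α β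
  download : ¬ e ∣ k → M ≤ downloadCut k d e β

theorem cast_eq_div_mul_add_mod (k e : ℕ) :
    (k : ℝ) = ((k / e : ℕ) : ℝ) * e + (k % e : ℕ) := by
  exact_mod_cast (Nat.div_add_mod' k e).symm

theorem CutScheme.repair_many {d e s y z t : ℕ} (h : CutScheme d e s y z t) (j : ℕ)
    (hj : s + j * e ≤ d) : ∃ z', CutScheme d e (s + j * e) y z' (t + j) ∧
      (z' : ℝ) = z + j * ((d : ℝ) - s) - e * j * (j - 1) / 2 := by
  induction j with
  | zero => exact ⟨z, by simpa using h, by simp⟩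
  | succ j ih =>
    rw [add_mul, one_mul, ← add_assoc] at hj
    obtain ⟨z', h1, h2⟩ := ih (by omega)
    refine ⟨z' + (d - (s + j * e)), ?_, ?_⟩
    · have := h1.repair le_rfl
      rwa [add_assoc, ← Nat.succ_mul, add_assoc] at this
    · rw [Nat.cast_add, h2, Nat.cast_sub (by omega)]
      push_cast
      ring

theorem exists_cutScheme_storageCut {k d e : ℕ} (hkd : k ≤ d) {j : ℕ} (hj : j ≤ k / e)
    (α β : ℝ) : ∃ y z, CutScheme d e k y z j ∧ y * α + z * β = storageCut k d e j α β := by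
  have hjk : j * e ≤ k := (Nat.mul_le_mul_right e hj).trans (Nat.div_mul_le_self k e)
  obtain ⟨z, h1, h2⟩ :=
    ((CutScheme.nil (d := d) (e := e)).store_many (k - j * e)).repair_many j (by omega)
  have hs : 0 + (k - j * e) + j * e = k := by omega
  rw [hs, zero_add, zero_add] at h1
  refine ⟨_, _, h1, ?_⟩
  rw [h2, zero_add, storageCut, Nat.cast_sub hjk]
  push_cast
  ring

theorem exists_cutScheme_downloadCut {k d e : ℕ} (he : 1 ≤ e) (hkd : k ≤ d) (β : ℝ) :
    ∃ z, CutScheme d e k 0 z (k / e + 1) ∧ (z : ℝ) * β = downloadCut k d e β := by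
  have hk := Nat.div_add_mod' k e
  obtain ⟨z, h1, h2⟩ := (CutScheme.nil (d := d) (e := e)).repair_many (k / e) (by omega)
  have h3 := h1.repair (Nat.mod_lt k he).le
  rw [zero_add, zero_add, hk] at h3
  refine ⟨_, h3, ?_⟩
  rw [Nat.cast_add, h2, Nat.cast_sub (by omega), downloadCut]
  push_cast
  ring

theorem feasible_of_codesExist {n k d e T : ℕ} {M α β : ℝ} (hC : CodesExist n k d e T M α β)
    (hM : 0 < M) (he : 1 ≤ e) (hkd : k ≤ d) (hdn : d + e ≤ n) (hT : k ≤ e * T) :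
    Feasible M k d e α β := by
  have hkT : k / e ≤ T := Nat.div_le_of_le_mul hT
  refine ⟨fun j hj => ?_, fun hek => ?_⟩
  · obtain ⟨y, z, h1, h2⟩ := exists_cutScheme_storageCut hkd hj α β
    rw [← h2]
    exact hC.le_of_cutScheme hM hkd hdn h1 (hj.trans hkT)
  · obtain ⟨z, h1, h2⟩ := exists_cutScheme_downloadCut he hkd β
    -- The last, incomplete repair brings the number to `k / e + 1`, which is `⌈k / e⌉` because `e ∤
    -- k`.
    have := hC.le_of_cutScheme hM hkd hdn h1 (by
      by_contra hlt
      have hTk : T = k / e := by omega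
      have h3 := Nat.div_add_mod k e
      rw [← hTk] at h3
      exact hek (Nat.dvd_of_mod_eq_zero (by omega)))
    simpa [h2] using this

/-- Storing nodes earlier only lowers the later downloads, so storage may be charged first. A node
produced by repair `l` saves `α` but is missing as a helper from repairs `0, …, l`, which leaves `l
+ 1` downloads uncancelled. -/
theorem CutScheme.exists_le {d e s y z t : ℕ} (h : CutScheme d e s y z t) (α : ℝ) {β : ℝ}
    (hβ : 0 ≤ β) : ∃ (j : ℕ) (u : ℕ → ℕ), (∀ l, u l ≤ e) ∧ ∑ l ∈ Finset.range j, u l ≤ s ∧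
      s * α + j * (((d : ℝ) - s) * β) + ∑ l ∈ Finset.range j, u l * (((l : ℝ) + 1) * β - α) ≤
        y * α + z * β := by
  induction h with
  | nil => exact ⟨0, fun _ => 0, by simp, by simp, by simp⟩
  | @store s y z t _ ih =>
    obtain ⟨j, u, h1, h2, h3⟩ := ih
    refine ⟨j, u, h1, by omega, ?_⟩
    have := mul_nonneg (Nat.cast_nonneg (α := ℝ) j) hβ
    push_cast
    linarith
  | @repair s y z t v _ hv ih =>
    obtain ⟨j, u, h1, h2, h3⟩ := ih
    obtain ⟨u', hlt, hj, hu'⟩ : ∃ u' : ℕ → ℕ, (∀ l ∈ Finset.range j, u' l = u l) ∧ u' j = v ∧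
        ∀ l, u' l ≤ e := by
      refine ⟨fun l => if l < j then u l else v, fun l hl => if_pos (Finset.mem_range.1 hl),
        if_neg (lt_irrefl j), fun l => ?_⟩
      by_cases h : l < j
      · simpa [h] using h1 l
      · simpa [h] using hv
    refine ⟨j + 1, u', hu', ?_, ?_⟩
    · rw [Finset.sum_range_succ, Finset.sum_congr rfl hlt, hj]
      exact Nat.add_le_add_right h2 v
    · have hsum : ∑ l ∈ Finset.range j, (u' l : ℝ) * (((l : ℝ) + 1) * β - α) =
          ∑ l ∈ Finset.range j, (u l : ℝ) * (((l : ℝ) + 1) * β - α) :=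
        Finset.sum_congr rfl fun l hl => by rw [hlt l hl]
      rw [Finset.sum_range_succ, hsum, hj]
      have h4 : ((d : ℝ) - s) * β ≤ ((d - s : ℕ) : ℝ) * β := by
        refine mul_le_mul_of_nonneg_right ?_ hβ
        rw [sub_le_iff_le_add]
        exact_mod_cast (by omega : d ≤ d - s + s)
      push_cast
      linarith

theorem storageCut_eq_sum (k d e j : ℕ) (α β : ℝ) :
    storageCut k d e j α β = k * α + ∑ l ∈ Finset.range j,
      (((d : ℝ) - k) * β + e * (((l : ℝ) + 1) * β - α)) := by
  induction j with
  | zero => simp [storageCut]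
  | succ j ih =>
    rw [Finset.sum_range_succ, ← add_assoc, ← ih, storageCut, storageCut]
    push_cast
    ring

/-- A last term with `c j ≥ 0` can be dropped; if `c j < 0`, all earlier coefficients are
nonpositive too, and every `u l` can be raised to `e`. -/
theorem exists_sum_le_of_monotone {e : ℕ} {c : ℕ → ℝ} (hc : Monotone c) {δ : ℝ} (hδ : 0 ≤ δ)
    {u : ℕ → ℕ} (hu : ∀ l, u l ≤ e) (j : ℕ) :
    ∃ i ≤ j, ∑ l ∈ Finset.range i, (δ + e * c l) ≤ ∑ l ∈ Finset.range j, (δ + u l * c l) := by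
  induction j with
  | zero => exact ⟨0, le_rfl, by simp⟩
  | succ j ih =>
    rcases le_or_gt 0 (c j) with h | h
    · obtain ⟨i, hi, hle⟩ := ih
      refine ⟨i, by omega, ?_⟩
      rw [Finset.sum_range_succ]
      have := mul_nonneg (Nat.cast_nonneg (α := ℝ) (u j)) h
      linarith
    · refine ⟨j + 1, le_rfl, Finset.sum_le_sum fun l hl => ?_⟩
      have h1 : c l ≤ 0 := (hc (Nat.lt_succ_iff.1 (Finset.mem_range.1 hl))).trans h.le
      have h2 : (u l : ℝ) ≤ e := by exact_mod_cast hu l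
      have := mul_le_mul_of_nonpos_right h2 h1
      linarith

/-- Relative to the level `c η`, the first `η` terms are nonpositive and the later ones nonnegative,
so filling the first `η` slots is optimal; the budget `k` leaves `r` units at level `c η`. -/
theorem sum_le_sum_of_exchange {e η r k j : ℕ} {c : ℕ → ℝ} (hc : Monotone c) (hη : c η ≤ 0)
    (hk : k = η * e + r) (hj : η ≤ j) {u : ℕ → ℕ} (hu : ∀ l, u l ≤ e)
    (hsum : ∑ l ∈ Finset.range j, u l ≤ k) :
    ∑ l ∈ Finset.range η, e * c l + r * c η ≤ ∑ l ∈ Finset.range j, u l * c l := by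
  have h1 : ∑ l ∈ Finset.range η, (e : ℝ) * (c l - c η) ≤
      ∑ l ∈ Finset.range j, u l * (c l - c η) := by
    refine le_trans (Finset.sum_le_sum (g := fun l => u l * (c l - c η)) fun l hl => ?_)
      (Finset.sum_le_sum_of_subset_of_nonneg (Finset.range_mono hj) fun l _ hl => ?_)
    · have h2 : (u l : ℝ) ≤ e := by exact_mod_cast hu l
      exact mul_le_mul_of_nonpos_right h2 (sub_nonpos.2 (hc (Finset.mem_range.1 hl).le))
    · exact mul_nonneg (Nat.cast_nonneg _)
        (sub_nonneg.2 (hc (not_lt.1 fun h => hl (Finset.mem_range.2 h))))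
  have h3 : (∑ l ∈ Finset.range j, u l : ℝ) ≤ η * e + r := by
    rw [hk] at hsum
    exact_mod_cast hsum
  have h4 := mul_le_mul_of_nonpos_right h3 hη
  simp only [mul_sub, Finset.sum_sub_distrib, Finset.sum_const, Finset.card_range,
    nsmul_eq_mul, ← Finset.sum_mul] at h1
  linarith

theorem Feasible.le_of_cutScheme {M : ℝ} {k d e : ℕ} {α β : ℝ} (hf : Feasible M k d e α β)
    (hβ : 0 ≤ β) (hkd : k ≤ d) {y z t : ℕ} (h : CutScheme d e k y z t) :
    M ≤ y * α + z * β := by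
  obtain ⟨j, u, hu, hsum, hle⟩ := h.exists_le α hβ
  refine le_trans ?_ hle
  set c : ℕ → ℝ := fun l => ((l : ℝ) + 1) * β - α with hc_def
  have hc : Monotone c := fun l l' hl => by
    have : (l : ℝ) ≤ l' := by exact_mod_cast hl
    simp only [hc_def]
    gcongr
  set δ := ((d : ℝ) - k) * β with hδ_def
  have hδ : 0 ≤ δ := mul_nonneg (sub_nonneg.2 (by exact_mod_cast hkd)) hβ
  have hsplit : k * α + j * δ + ∑ l ∈ Finset.range j, u l * c l =
      k * α + ∑ l ∈ Finset.range j, (δ + u l * c l) := by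
    rw [Finset.sum_add_distrib, Finset.sum_const, Finset.card_range, nsmul_eq_mul, add_assoc]
  -- In the first case more than `k / e` repairs are used and the budget `k` binds: the comparison
  -- is with the cut that downloads everything. Otherwise the terms from index `k / e` on are absent
  -- or nonnegative, and the budget plays no role.
  by_cases hcase : k / e < j ∧ c (k / e) < 0
  · obtain ⟨hj, hneg⟩ := hcase
    have h1 := sum_le_sum_of_exchange hc hneg.le (Nat.div_add_mod' k e).symm hj.le hu hsum
    have h2 : ((k / e : ℕ) + 1) * δ ≤ j * δ :=
      mul_le_mul_of_nonneg_right (by exact_mod_cast hj) hδ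
    have h3 := storageCut_eq_sum k d e (k / e) α β
    rw [Finset.sum_add_distrib, Finset.sum_const, Finset.card_range, nsmul_eq_mul] at h3
    by_cases hek : e ∣ k
    · have h4 := hf.storage (k / e) le_rfl
      rw [Nat.mod_eq_zero_of_dvd hek] at h1
      push_cast at h1
      linarith
    · refine (hf.download hek).trans (le_trans (le_of_eq ?_)
        (add_le_add (add_le_add (le_refl (k * α)) h2) h1))
      have h5 : k * α + ((k / e : ℕ) + 1) * δ +
          (∑ l ∈ Finset.range (k / e), e * c l + (k % e : ℕ) * c (k / e)) =
          storageCut k d e (k / e) α β + δ + (k % e : ℕ) * c (k / e) := by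
        rw [h3]; ring
      rw [h5, storageCut, downloadCut, hδ_def, hc_def, cast_eq_div_mul_add_mod k e]
      ring
  · rw [hsplit]
    obtain ⟨i, hi, h1⟩ := exists_sum_le_of_monotone hc hδ hu (min j (k / e))
    have h2 : ∑ l ∈ Finset.range (min j (k / e)), (δ + u l * c l) ≤
        ∑ l ∈ Finset.range j, (δ + u l * c l) := by
      refine Finset.sum_le_sum_of_subset_of_nonneg (Finset.range_mono (min_le_left _ _))
        fun l hl hl' => ?_
      rw [Finset.mem_range] at hl hl'
      have h3 : 0 ≤ c l := by
        have h4 : 0 ≤ c (k / e) := by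
          by_contra hlt
          exact hcase ⟨by omega, not_le.1 hlt⟩
        exact h4.trans (hc (by omega))
      exact add_nonneg hδ (mul_nonneg (Nat.cast_nonneg _) h3)
    have h3 := hf.storage i (hi.trans (min_le_right _ _))
    rw [storageCut_eq_sum] at h3
    linarith

/-! ### Codes for feasible parameters. -/

theorem Feasible.hasCode_of_rat {M : ℝ} {n k d e : ℕ} {α β : ℝ} (hf : Feasible M k d e α β)
    (hM : 0 < M) (hβ : 0 < β) (hkd : k ≤ d) (q : ℚ) (hq : α = q * β) (T : ℕ) :
    HasCode n k d e T M α β := by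
  have h0 := hf.storage 0 (Nat.zero_le _)
  simp only [storageCut, Nat.cast_zero, zero_mul, sub_zero, mul_zero, zero_div, add_zero] at h0
  have hα : 0 < α := by
    by_contra hlt
    have := mul_nonpos_of_nonneg_of_nonpos (Nat.cast_nonneg (α := ℝ) k) (not_lt.1 hlt)
    linarith
  have hq0 : 0 < q := by
    rw [hq] at hα
    exact_mod_cast (pos_iff_pos_of_mul_pos hα).2 hβ
  have hqq : (q : ℝ) = (q.num.toNat : ℝ) / q.den := by
    have h1 : ((q.num.toNat : ℤ) : ℝ) = (q.num : ℝ) := by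
      rw [Int.toNat_of_nonneg (Rat.num_pos.2 hq0).le]
    rw [← Int.cast_natCast, h1]
    exact Rat.cast_def q
  have hcut := fun y z t h => hf.le_of_cutScheme hβ.le hkd (y := y) (z := z) (t := t) h
  rw [hq, hqq] at hcut ⊢
  exact hasCode_of_forall_cutScheme hβ _ _ q.den_pos hcut T

theorem exists_rat_mul_between {β x y : ℝ} (hβ : 0 < β) (hxy : x < y) :
    ∃ q : ℚ, x < q * β ∧ q * β < y := by
  obtain ⟨q, h1, h2⟩ := exists_rat_btwn (div_lt_div_of_pos_right hxy hβ)
  exact ⟨q, (div_lt_iff₀ hβ).1 h1, (lt_div_iff₀ hβ).1 h2⟩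

theorem storageCut_mono {k d e j : ℕ} (hj : j ≤ k / e) {α α' : ℝ} (hα : α ≤ α') (β : ℝ) :
    storageCut k d e j α β ≤ storageCut k d e j α' β := by
  have hjk : (j : ℝ) * e ≤ k := by
    exact_mod_cast (Nat.mul_le_mul_right e hj).trans (Nat.div_mul_le_self k e)
  unfold storageCut
  gcongr

theorem Feasible.mono {M : ℝ} {k d e : ℕ} {α α' β : ℝ} (hf : Feasible M k d e α β)
    (hα : α ≤ α') : Feasible M k d e α' β :=
  ⟨fun j hj => (hf.storage j hj).trans (storageCut_mono hj hα β), hf.download⟩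

theorem Feasible.codesExist {M : ℝ} {n k d e : ℕ} {α β : ℝ} (hf : Feasible M k d e α β)
    (hM : 0 < M) (hβ : 0 < β) (hkd : k ≤ d) (T : ℕ) : CodesExist n k d e T M α β := by
  intro M' hM'
  have h0 := hf.storage 0 (Nat.zero_le _)
  simp only [storageCut, Nat.cast_zero, zero_mul, sub_zero, mul_zero, zero_div, add_zero] at h0
  have hα : 0 < α := by
    by_contra hlt
    have := mul_nonpos_of_nonneg_of_nonpos (Nat.cast_nonneg (α := ℝ) k) (not_lt.1 hlt)
    linarith
  set M₁ := max M' (M / 2) with hM₁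
  have hM₁0 : 0 < M₁ := lt_max_of_lt_right (by linarith)
  have hM₁M : M₁ < M := max_lt hM' (by linarith)
  have hratio : M₁ / M < 1 := (div_lt_one hM).2 hM₁M
  obtain ⟨q, hq1, hq2⟩ := exists_rat_mul_between hβ
    (show M₁ / M * α < α from mul_lt_of_lt_one_left hα hratio)
  have hr0 : 0 ≤ M₁ / M := by positivity
  -- Only `α` is scaled along with the file size. The `β` part of each cut is nonnegative and need
  -- not shrink, which leaves room below `α` for a rational multiple of the same `β`.
  have hscaled : Feasible M₁ k d e (M₁ / M * α) β := by
    have hM₁' : M₁ = M₁ / M * M := by field_simp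
    refine ⟨fun j hj => ?_, fun hek => hM₁M.le.trans (hf.download hek)⟩
    have h1 := mul_le_mul_of_nonneg_left (hf.storage j hj) hr0
    rw [← hM₁'] at h1
    refine h1.trans ?_
    have hdk : (k : ℝ) ≤ d := by exact_mod_cast hkd
    have h2 : 0 ≤ (j * ((d : ℝ) - k) + e * j * (j + 1) / 2) * β :=
      mul_nonneg (add_nonneg (mul_nonneg (Nat.cast_nonneg _) (sub_nonneg.2 hdk))
        (by positivity)) hβ.le
    have h3 := mul_le_mul_of_nonneg_right hratio.le h2
    simp only [storageCut]
    linarith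
  exact ((hscaled.mono hq1.le).hasCode_of_rat hM₁0 hβ hkd q rfl T).mono (le_max_left _ _) hq2.le

/-! ### The threshold and its closed form. -/

section threshold

variable {M : ℝ} {k d e : ℕ}

theorem storageCut_sub (k d e j j' : ℕ) (α β : ℝ) :
    storageCut k d e j' α β - storageCut k d e j α β =
      ((j' : ℝ) - j) * (((d : ℝ) - k) * β - e * α + e * ((j' : ℝ) + j + 1) / 2 * β) := by
  unfold storageCut
  ring

/-- In `j` the cut value is a convex quadratic, with increment `(d - k + j e) β - e α` from `j - 1`
to `j`; the sign conditions on both sides of `j` make it a global minimum. -/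
theorem storageCut_le_of_increments {j : ℕ} {α β : ℝ} (hβ : 0 ≤ β)
    (hA : 1 ≤ j → ((d : ℝ) - k + j * e) * β ≤ e * α)
    (hB : j < k / e → e * α ≤ ((d : ℝ) - k + (j + 1) * e) * β) {j' : ℕ} (hj' : j' ≤ k / e) :
    storageCut k d e j α β ≤ storageCut k d e j' α β := by
  rw [← sub_nonneg, storageCut_sub]
  have heβ : 0 ≤ e * β := mul_nonneg (Nat.cast_nonneg _) hβ
  rcases lt_trichotomy j' j with h | rfl | h
  · have h1 : (j' : ℝ) + 1 ≤ j := by exact_mod_cast h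
    have h2 := hA (by omega)
    have h3 := mul_le_mul_of_nonneg_right h1 heβ
    refine mul_nonneg_of_nonpos_of_nonpos (by linarith) ?_
    linarith
  · simp
  · have h1 : (j : ℝ) + 1 ≤ j' := by exact_mod_cast h
    have h2 := hB (by omega)
    have h3 := mul_le_mul_of_nonneg_right h1 heβ
    refine mul_nonneg (by linarith) ?_
    linarith

theorem div_mul_cast_le (k e : ℕ) : ((k / e : ℕ) : ℝ) * e ≤ k := by
  exact_mod_cast Nat.div_mul_le_self k e

theorem downloadCut_coeff_pos (hk : 1 ≤ k) (hkd : k ≤ d) :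
    0 < ((k / e : ℕ) + 1) * (d : ℝ) - e * (k / e : ℕ) * ((k / e : ℕ) + 1) / 2 := by
  have h1 := div_mul_cast_le k e
  have h2 : (k : ℝ) ≤ d := by exact_mod_cast hkd
  have h3 : (1 : ℝ) ≤ k := by exact_mod_cast hk
  have h4 : (0 : ℝ) ≤ (k / e : ℕ) := Nat.cast_nonneg _
  have : ((k / e : ℕ) + 1) * (d : ℝ) - e * (k / e : ℕ) * ((k / e : ℕ) + 1) / 2 =
    ((k / e : ℕ) + 1) * ((d : ℝ) - (k / e : ℕ) * e / 2) := by ring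
  rw [this]
  exact mul_pos (by linarith) (by linarith)

theorem storageCut_coeff_pos (hkd : k ≤ d) (he : 1 ≤ e) {j : ℕ} (hj : 1 ≤ j) :
    0 < j * ((d : ℝ) - k) + e * j * (j + 1) / 2 := by
  have h2 : (0 : ℝ) ≤ (d : ℝ) - k := sub_nonneg.2 (by exact_mod_cast hkd)
  have h3 : (0 : ℝ) < e := by exact_mod_cast he
  have h4 : (0 : ℝ) < j := by exact_mod_cast hj
  positivity

theorem choose_two_div (k e : ℕ) : ((k / e : ℕ) + 1) * (d : ℝ) -
      e * (Nat.choose (k / e + 1) 2 : ℝ) =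
    ((k / e : ℕ) + 1) * (d : ℝ) - e * (k / e : ℕ) * ((k / e : ℕ) + 1) / 2 := by
  rw [Nat.cast_choose_two]
  push_cast
  ring

/-- If `e ∣ k`, the cut through all the repairs does not involve the storage. -/
theorem storageCut_div_of_dvd (hek : e ∣ k) (α β : ℝ) : storageCut k d e (k / e) α β =
    ((k / e : ℕ) * ((d : ℝ) - k) + e * (k / e : ℕ) * ((k / e : ℕ) + 1) / 2) * β := by
  have h := cast_eq_div_mul_add_mod k e
  rw [Nat.mod_eq_zero_of_dvd hek, Nat.cast_zero, add_zero] at h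
  rw [storageCut, ← h, sub_self, zero_mul, zero_add]

/-- `gammaMin` is the bandwidth at which the cut free of `α` equals `M`. This cut is `storageCut (k
/ e)` or `downloadCut` according to divisibility, and for `k ≤ e` its value is `γ`. -/
theorem gammaMin_le_iff (hk : 1 ≤ k) (he : 1 ≤ e) (hkd : k ≤ d) (α γ : ℝ) :
    gammaMin M k d e ≤ γ ↔ (e ∣ k → M ≤ storageCut k d e (k / e) α (γ / d)) ∧
      (¬ e ∣ k → M ≤ downloadCut k d e (γ / d)) := by
  have hd0 : (0 : ℝ) < d := by exact_mod_cast (by omega : 0 < d)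
  have he0 : (0 : ℝ) < e := by exact_mod_cast he
  by_cases hek : e ∣ k
  · have hη : 1 ≤ k / e := Nat.div_pos (Nat.le_of_dvd hk hek) he
    have hpos := storageCut_coeff_pos hkd he hη
    have hk' := cast_eq_div_mul_add_mod k e
    rw [Nat.mod_eq_zero_of_dvd hek, Nat.cast_zero, add_zero] at hk'
    simp only [hek, true_imp_iff, not_true, false_imp_iff, and_true,
      storageCut_div_of_dvd hek]
    unfold gammaMin
    split_ifs with hke
    · have hk1 : k = e := le_antisymm hke (Nat.le_of_dvd hk hek)
      subst hk1
      rw [Nat.div_self he]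
      have : ((1 : ℕ) * ((d : ℝ) - k) + k * (1 : ℕ) * ((1 : ℕ) + 1) / 2) * (γ / d) = γ := by
        push_cast
        field_simp
        ring
      rw [this]
    · have h1 : breakpoint M k d e 0 0 = d * M /
          ((k / e : ℕ) * ((d : ℝ) - k) + e * (k / e : ℕ) * ((k / e : ℕ) + 1) / 2) := by
        rw [breakpoint, div_eq_div_iff _ hpos.ne']
        · rw [hk']
          push_cast
          ring
        · have : -(k : ℝ) ^ 2 - ((0 : ℕ) : ℝ) ^ 2 + e * ((k : ℝ) - (0 : ℕ)) + 2 * k * d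
            - (e : ℝ) ^ 2 * (((0 : ℕ) : ℝ) ^ 2 + (0 : ℕ)) - 2 * (0 : ℕ) * e * (0 : ℕ) = 2 * e *
            ((k / e : ℕ) * ((d : ℝ) - k) + e * (k / e : ℕ) * ((k / e : ℕ) + 1) / 2) := by
            rw [hk']
            push_cast
            ring
          rw [this]
          positivity
      rw [h1, div_le_iff₀ hpos, mul_div_assoc', le_div_iff₀ hd0, mul_comm M, mul_comm γ]
  · have hpos := downloadCut_coeff_pos (e := e) hk hkd
    simp only [hek, false_imp_iff, true_and, not_false_iff, true_imp_iff, downloadCut]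
    unfold gammaMin
    split_ifs with hke
    · have hk1 : k / e = 0 :=
        Nat.div_eq_of_lt (lt_of_le_of_ne hke fun h => hek (h ▸ dvd_rfl))
      rw [hk1]
      have : (((0 : ℕ) + 1) * (d : ℝ) - e * (0 : ℕ) * ((0 : ℕ) + 1) / 2) * (γ / d) = γ := by
        push_cast
        field_simp
        ring
      rw [this]
    · rw [choose_two_div, div_le_iff₀ hpos, mul_div_assoc', le_div_iff₀ hd0, mul_comm M,
        mul_comm γ]

theorem gammaMin_pos (hM : 0 < M) (hk : 1 ≤ k) (he : 1 ≤ e) (hkd : k ≤ d) :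
    0 < gammaMin M k d e := by
  by_contra! hle
  have h := (gammaMin_le_iff hk he hkd 0 0).1 hle
  by_cases hek : e ∣ k
  · have := h.1 hek
    rw [storageCut_div_of_dvd hek] at this
    simp at this
    linarith
  · have := h.2 hek
    simp [downloadCut] at this
    linarith

/-- The indices of the cuts that involve the storage. -/
def storageCutIndices (k e : ℕ) : Finset ℕ :=
  (Finset.range (k / e + 1)).filter fun j => j * e < k

theorem mem_storageCutIndices {j : ℕ} :
    j ∈ storageCutIndices k e ↔ j ≤ k / e ∧ j * e < k := by
  rw [storageCutIndices, Finset.mem_filter, Finset.mem_range, Nat.lt_succ_iff]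

/-- The storage needed for the cut with index `j`. -/
noncomputable def storageLine (M : ℝ) (k d e j : ℕ) (γ : ℝ) : ℝ :=
  (M - (j * ((d : ℝ) - k) + e * j * (j + 1) / 2) * (γ / d)) / ((k : ℝ) - j * e)

theorem storageLine_le_iff {j : ℕ} (hj : j ∈ storageCutIndices k e) (γ α : ℝ) :
    storageLine M k d e j γ ≤ α ↔ M ≤ storageCut k d e j α (γ / d) := by
  have h : (0 : ℝ) < (k : ℝ) - j * e :=
    sub_pos.2 (by exact_mod_cast (mem_storageCutIndices.1 hj).2)
  rw [storageLine, div_le_iff₀ h, storageCut, sub_le_iff_le_add, mul_comm α]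

theorem storageCut_storageLine {j : ℕ} (hj : j ∈ storageCutIndices k e) (γ : ℝ) :
    storageCut k d e j (storageLine M k d e j γ) (γ / d) = M := by
  have h : (k : ℝ) - j * e ≠ 0 :=
    (sub_pos.2 (by exact_mod_cast (mem_storageCutIndices.1 hj).2)).ne'
  rw [storageLine, storageCut, mul_div_cancel₀ _ h]
  ring

/-- The least storage per node for the total bandwidth `γ`. -/
noncomputable def storageThreshold (M : ℝ) (k d e : ℕ) (γ : ℝ) : ℝ :=
  if h : (storageCutIndices k e).Nonempty then
    (storageCutIndices k e).sup' h fun j => storageLine M k d e j γ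
  else 0

theorem storageThreshold_le_iff (hk : 1 ≤ k) (γ α : ℝ) : storageThreshold M k d e γ ≤ α ↔
    ∀ j ∈ storageCutIndices k e, M ≤ storageCut k d e j α (γ / d) := by
  have h : (storageCutIndices k e).Nonempty :=
    ⟨0, mem_storageCutIndices.2 ⟨Nat.zero_le _, by omega⟩⟩
  rw [storageThreshold, dif_pos h, Finset.sup'_le_iff]
  exact forall₂_congr fun j hj => storageLine_le_iff hj γ α

theorem feasible_iff (hk : 1 ≤ k) (he : 1 ≤ e) (hkd : k ≤ d) (γ α : ℝ) :
    Feasible M k d e α (γ / d) ↔ gammaMin M k d e ≤ γ ∧ storageThreshold M k d e γ ≤ α := by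
  rw [storageThreshold_le_iff hk, gammaMin_le_iff hk he hkd α]
  constructor
  · exact fun h => ⟨⟨fun _ => h.storage _ le_rfl, h.download⟩,
      fun j hj => h.storage j (mem_storageCutIndices.1 hj).1⟩
  · rintro ⟨⟨h1, h2⟩, h3⟩
    refine ⟨fun j hj => ?_, h2⟩
    by_cases hjk : j * e < k
    · exact h3 j (mem_storageCutIndices.2 ⟨hj, hjk⟩)
    -- The only index left out is `j = k / e` with `e ∣ k`, where `α` has coefficient 0.
    · have h4 := Nat.div_mul_le_self k e
      have h5 := Nat.mul_le_mul_right e hj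
      have h6 : k / e * e = k := by omega
      have h7 : j = k / e := Nat.eq_of_mul_eq_mul_right he (by omega)
      rw [h7]
      exact h1 ⟨k / e, by rw [mul_comm, h6]⟩

theorem storageThreshold_eq (hk : 1 ≤ k) {j : ℕ} {γ : ℝ} (hγ : 0 ≤ γ)
    (hj : j ∈ storageCutIndices k e)
    (hA : 1 ≤ j → ((d : ℝ) - k + j * e) * (γ / d) ≤ e * storageLine M k d e j γ)
    (hB : j < k / e → e * storageLine M k d e j γ ≤ ((d : ℝ) - k + (j + 1) * e) * (γ / d)) :
    storageThreshold M k d e γ = storageLine M k d e j γ := by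
  refine le_antisymm ((storageThreshold_le_iff hk _ _).2 fun j' hj' => ?_)
    ((storageLine_le_iff hj _ _).2 ((storageThreshold_le_iff hk _ _).1 le_rfl j hj))
  have h := storageCut_le_of_increments (div_nonneg hγ (Nat.cast_nonneg d)) hA hB
    (mem_storageCutIndices.1 hj').1
  rwa [storageCut_storageLine hj] at h

theorem offset_eq (hd : 1 ≤ d) {i : ℕ} (hi : i ≤ k / e) : offset k d e (k % e) i =
    ((k / e - i : ℕ) * ((d : ℝ) - k) + e * (k / e - i : ℕ) * ((k / e - i : ℕ) + 1) / 2) / d := by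
  have hd0 : (d : ℝ) ≠ 0 := by exact_mod_cast (by omega : d ≠ 0)
  rw [offset, Nat.cast_sub hi, div_eq_div_iff (by simpa using hd0) hd0,
    cast_eq_div_mul_add_mod k e, ← cast_eq_div_mul_add_mod k e]
  have := cast_eq_div_mul_add_mod k e
  generalize ((k / e : ℕ) : ℝ) = η at *
  generalize ((k % e : ℕ) : ℝ) = r at *
  rw [this]
  ring

theorem cast_mod_add_mul {i : ℕ} (hi : i ≤ k / e) :
    ((k % e : ℕ) : ℝ) + i * e = (k : ℝ) - (k / e - i : ℕ) * e := by
  rw [Nat.cast_sub hi]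
  have := cast_eq_div_mul_add_mod k e
  linarith

theorem storageLine_eq (hd : 1 ≤ d) {i : ℕ} (hi : i ≤ k / e) (γ : ℝ) :
    storageLine M k d e (k / e - i) γ =
      (M - γ * offset k d e (k % e) i) / ((k % e : ℕ) + i * e) := by
  rw [storageLine, offset_eq hd hi, cast_mod_add_mul hi]
  ring

/-- In this form `f_r(i)` is visibly the solution of `e α = (d - r - i e) γ / d` on line `i`, that
is, the crossing of lines `i` and `i + 1`. Line `i` belongs to the cut with `j = k / e - i`. -/
theorem breakpoint_eq (hd : 1 ≤ d) {i : ℕ} (hi : i ≤ k / e) :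
    breakpoint M k d e (k % e) i = e * d * M /
      (((k % e : ℕ) + i * e) * ((d : ℝ) - (k % e : ℕ) - i * e) +
        e * (d * offset k d e (k % e) i)) := by
  have hd0 : (d : ℝ) ≠ 0 := by exact_mod_cast (by omega : d ≠ 0)
  have : -(k : ℝ) ^ 2 - ((k % e : ℕ) : ℝ) ^ 2 + e * ((k : ℝ) - (k % e : ℕ)) + 2 * k * d
      - (e : ℝ) ^ 2 * ((i : ℝ) ^ 2 + i) - 2 * i * e * (k % e : ℕ) =
      2 * (((k % e : ℕ) + i * e) * ((d : ℝ) - (k % e : ℕ) - i * e) +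
        e * (d * offset k d e (k % e) i)) := by
    have h1 := cast_eq_div_mul_add_mod k e
    rw [offset_eq hd hi, mul_div_cancel₀ _ hd0, Nat.cast_sub hi]
    generalize ((k / e : ℕ) : ℝ) = η at *
    generalize ((k % e : ℕ) : ℝ) = r at *
    rw [h1]
    ring
  rw [breakpoint, this, mul_assoc 2, mul_assoc 2, mul_div_mul_left _ _ two_ne_zero]

theorem breakpoint_den_pos (he : 1 ≤ e) (hk : 1 ≤ k) (hkd : k ≤ d) {i : ℕ} (hi : i < k / e) :
    0 < ((k % e : ℕ) + i * e) * ((d : ℝ) - (k % e : ℕ) - i * e) +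
      e * (d * offset k d e (k % e) i) := by
  have hd0 : (0 : ℝ) < d := by exact_mod_cast (by omega : 0 < d)
  have he0 : (0 : ℝ) < e := by exact_mod_cast he
  have hkd' : (k : ℝ) ≤ d := by exact_mod_cast hkd
  rw [offset_eq (by omega) hi.le, mul_div_cancel₀ _ hd0.ne']
  have h1 := storageCut_coeff_pos (d := d) hkd he (j := k / e - i) (by omega)
  have h2 := cast_mod_add_mul hi.le
  have h3 : (0 : ℝ) ≤ (k / e - i : ℕ) * e := by positivity
  have h4 : (0 : ℝ) ≤ (k % e : ℕ) + i * e := by positivity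
  exact add_pos_of_nonneg_of_pos (mul_nonneg h4 (by linarith)) (mul_pos he0 h1)

/-- The closed form of the threshold. -/
theorem storageThreshold_eq_of_mem (hk : 1 ≤ k) (he : 1 ≤ e) (hkd : k ≤ d) {i : ℕ}
    (hi : i ≤ k / e) (hpos : 0 < k % e + i * e) {γ : ℝ} (hγ : 0 ≤ γ)
    (hA : i < k / e → γ ≤ breakpoint M k d e (k % e) i)
    (hB : 1 ≤ i → breakpoint M k d e (k % e) (i - 1) ≤ γ) :
    storageThreshold M k d e γ =
      (M - γ * offset k d e (k % e) i) / ((k % e : ℕ) + i * e) := by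
  have hd : 1 ≤ d := by omega
  have hd0 : (0 : ℝ) < d := by exact_mod_cast (by omega : 0 < d)
  have hpos' : (0 : ℝ) < (k % e : ℕ) + i * e := by exact_mod_cast hpos
  have hsub := cast_mod_add_mul hi
  rw [← storageLine_eq hd hi]
  have hkey : ((d : ℝ) - k + (k / e - i : ℕ) * e) = (d : ℝ) - (k % e : ℕ) - i * e := by
    linarith
  refine storageThreshold_eq hk hγ (mem_storageCutIndices.2 ⟨Nat.sub_le _ _, ?_⟩) (fun hj => ?_)
    fun hj => ?_
  · have h1 : (0 : ℝ) < (k : ℝ) - (k / e - i : ℕ) * e := hsub ▸ hpos'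
    exact_mod_cast sub_pos.1 h1
  · have hA' := hA (by omega)
    rw [breakpoint_eq hd hi, le_div_iff₀ (breakpoint_den_pos he hk hkd (by omega))] at hA'
    rw [hkey, storageLine_eq hd hi, ← mul_div_assoc, ← mul_div_assoc, div_le_div_iff₀ hd0 hpos']
    linarith
  · have hi1 : 1 ≤ i := by omega
    have hB' := hB hi1
    rw [breakpoint_eq hd (by omega),
      div_le_iff₀ (breakpoint_den_pos he hk hkd (by omega))] at hB'
    -- Rewrites the breakpoint `i - 1` in terms of line `i`, on which the inequality is to be
    -- proved.
    have hoff : d * offset k d e (k % e) (i - 1) =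
        d * offset k d e (k % e) i + ((d : ℝ) - (k % e : ℕ) - i * e + e) := by
      rw [offset_eq hd hi, offset_eq hd (by omega), mul_div_cancel₀ _ hd0.ne',
        mul_div_cancel₀ _ hd0.ne', ← hkey, Nat.cast_sub hi, Nat.cast_sub (by omega),
        Nat.cast_sub hi1]
      push_cast
      ring
    rw [hoff, Nat.cast_sub hi1, Nat.cast_one] at hB'
    have hkey' : ((d : ℝ) - k + ((k / e - i : ℕ) + 1) * e) =
        (d : ℝ) - (k % e : ℕ) - i * e + e := by linarith
    rw [hkey', storageLine_eq hd hi, ← mul_div_assoc, ← mul_div_assoc, div_le_div_iff₀ hpos' hd0]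
    linarith

end threshold

/-! ### The minimum storage and minimum bandwidth points. -/

section extreme_points

variable {n k d e T : ℕ} {M : ℝ}

theorem codesExist_iff_feasible (hk : 1 ≤ k) (he : 1 ≤ e) (hkd : k ≤ d) (hdn : d + e ≤ n)
    (hM : 0 < M) (hT : k ≤ e * T) (α γ : ℝ) :
    CodesExist n k d e T M α (γ / d) ↔ Feasible M k d e α (γ / d) := by
  refine ⟨fun h => feasible_of_codesExist h hM he hkd hdn hT, fun h => ?_⟩
  have hγ := (gammaMin_pos hM hk he hkd).trans_le ((feasible_iff hk he hkd γ α).1 h).1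
  exact h.codesExist hM (div_pos hγ (by exact_mod_cast (by omega : 0 < d))) hkd T

theorem feasible_of_increments {j : ℕ} {α β : ℝ} (hβ : 0 ≤ β) (hj : M ≤ storageCut k d e j α β)
    (hA : 1 ≤ j → ((d : ℝ) - k + j * e) * β ≤ e * α)
    (hB : j < k / e → e * α ≤ ((d : ℝ) - k + (j + 1) * e) * β)
    (hD : ¬ e ∣ k → M ≤ downloadCut k d e β) : Feasible M k d e α β :=
  ⟨fun _ hj' => hj.trans (storageCut_le_of_increments hβ hA hB hj'), hD⟩

theorem storageCut_zero (k d e : ℕ) (α β : ℝ) : storageCut k d e 0 α β = k * α := by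
  simp [storageCut]

theorem downloadCut_sub_storageCut (k d e : ℕ) (α β : ℝ) :
    downloadCut k d e β - storageCut k d e (k / e) α β =
      ((d : ℝ) + (k / e : ℕ) * (k % e : ℕ) - e * (k / e : ℕ)) * β - (k % e : ℕ) * α := by
  have h := cast_eq_div_mul_add_mod k e
  rw [downloadCut, storageCut]
  generalize ((k / e : ℕ) : ℝ) = η at *
  generalize ((k % e : ℕ) : ℝ) = r at *
  rw [h]
  ring

theorem feasible_iff_of_le (hk : 1 ≤ k) (he : 1 ≤ e) (hkd : k ≤ d) (hke : k ≤ e) (α γ : ℝ) :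
    Feasible M k d e α (γ / d) ↔ M / k ≤ α ∧ M ≤ γ := by
  have hk0 : (0 : ℝ) < k := by exact_mod_cast hk
  have hγ : gammaMin M k d e = M := if_pos hke
  rw [feasible_iff hk he hkd, hγ, and_comm, storageThreshold_le_iff hk, div_le_iff₀ hk0,
    mul_comm α]
  have : ∀ j, j ∈ storageCutIndices k e ↔ j = 0 := by
    intro j
    rw [mem_storageCutIndices]
    constructor
    · rintro ⟨-, h⟩
      by_contra h0
      have := Nat.le_mul_of_pos_left e (Nat.pos_of_ne_zero h0)
      omega
    · rintro rfl
      exact ⟨Nat.zero_le _, by omega⟩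
  simp only [this, forall_eq, storageCut_zero]

theorem isMSMR_and_isMBMR_of_le (hk : 1 ≤ k) (he : 1 ≤ e) (hkd : k ≤ d) (hdn : d + e ≤ n)
    (hM : 0 < M) (hT : k ≤ e * T) (hke : k ≤ e) :
    IsMSMR n k d e T M (M / k) M ∧ IsMBMR n k d e T M (M / k) M := by
  simp only [IsMSMR, IsMBMR, codesExist_iff_feasible hk he hkd hdn hM hT,
    feasible_iff_of_le hk he hkd hke]
  exact ⟨⟨⟨⟨M, le_rfl, le_rfl⟩, fun _ ⟨_, h, _⟩ => h⟩, ⟨le_rfl, le_rfl⟩, fun _ h => h.2⟩,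
    ⟨⟨M / k, le_rfl, le_rfl⟩, fun _ ⟨_, _, h⟩ => h⟩, ⟨le_rfl, le_rfl⟩, fun _ h => h.1⟩

/-- The cut `j = 0` forces `α = M / k`, and then `j = 1` forces `γ`. At this point the first
increment vanishes, so by convexity no other storage cut is smaller. -/
theorem isMSMR_of_lt (hk : 1 ≤ k) (he : 1 ≤ e) (hkd : k ≤ d) (hdn : d + e ≤ n)
    (hM : 0 < M) (hT : k ≤ e * T) (hek : e < k) :
    IsMSMR n k d e T M (M / k) (M * e * d / (k * ((d : ℝ) - k + e))) := by
  have hk0 : (0 : ℝ) < k := by exact_mod_cast hk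
  have he0 : (0 : ℝ) < e := by exact_mod_cast he
  have hd0 : (0 : ℝ) < d := by exact_mod_cast (by omega : 0 < d)
  have hkd' : (k : ℝ) ≤ d := by exact_mod_cast hkd
  have hden : (0 : ℝ) < (d : ℝ) - k + e := by linarith
  have hη : 1 ≤ k / e := Nat.div_pos hek.le he
  have hβ : M * e * d / (k * ((d : ℝ) - k + e)) / d = M * e / (k * ((d : ℝ) - k + e)) := by
    field_simp
  have hβ0 : 0 ≤ M * e / (k * ((d : ℝ) - k + e)) := by positivity
  have hinc : (e : ℝ) * (M / k) = ((d : ℝ) - k + e) * (M * e / (k * ((d : ℝ) - k + e))) := by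
    field_simp
  have hmem : Feasible M k d e (M / k) (M * e * d / (k * ((d : ℝ) - k + e)) / d) := by
    rw [hβ]
    have hst : ∀ j ≤ k / e,
        M ≤ storageCut k d e j (M / k) (M * e / (k * ((d : ℝ) - k + e))) := by
      intro j hj
      have := storageCut_le_of_increments (k := k) (d := d) (e := e) (j := 0) (α := M / k) hβ0
        (by omega) (fun _ => by rw [hinc]; simp) hj
      rw [storageCut_zero, mul_div_cancel₀ _ hk0.ne'] at this
      exact this
    refine ⟨hst, fun _ => (hst _ le_rfl).trans ?_⟩
    rw [← sub_nonneg, downloadCut_sub_storageCut]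
    generalize M * e / (k * ((d : ℝ) - k + e)) = β at *
    have hα : M / k = ((d : ℝ) - k + e) * β / e := by
      rw [← hinc]; field_simp
    have hr : ((k % e : ℕ) : ℝ) ≤ e := by exact_mod_cast (Nat.mod_lt k he).le
    have hr0 : (0 : ℝ) ≤ (k % e : ℕ) := Nat.cast_nonneg _
    have hη' : (1 : ℝ) ≤ (k / e : ℕ) := by exact_mod_cast hη
    have hkk := cast_eq_div_mul_add_mod k e
    rw [hα]
    generalize ((k / e : ℕ) : ℝ) = η at *
    generalize ((k % e : ℕ) : ℝ) = r at *
    -- The excess of the download cut over the last storage cut, arranged into nonnegative terms.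
    have : (d + η * r - e * η) * β - r * (((d : ℝ) - k + e) * β / e) =
        ((e - r) * (d - k) + (e - r) * r + r * (η - 1) * e + r * r) * β / e := by
      rw [hkk]
      field_simp
      ring
    rw [this]
    have h1 : 0 ≤ (e - r) * ((d : ℝ) - k) := mul_nonneg (by linarith) (by linarith)
    have h2 : 0 ≤ ((e : ℝ) - r) * r := mul_nonneg (by linarith) hr0
    have h3 : 0 ≤ r * (η - 1) * e := mul_nonneg (mul_nonneg hr0 (by linarith)) he0.le
    exact div_nonneg (mul_nonneg (by nlinarith) hβ0) he0.le
  simp only [IsMSMR, codesExist_iff_feasible hk he hkd hdn hM hT]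
  refine ⟨⟨⟨_, hmem⟩, ?_⟩, hmem, ?_⟩
  · rintro a ⟨c, h⟩
    have := h.storage 0 (Nat.zero_le _)
    rw [storageCut_zero] at this
    rw [div_le_iff₀ hk0]
    linarith
  · intro c h
    have := h.storage 1 hη
    have h1 : storageCut k d e 1 (M / k) (c / d) =
        M + (((d : ℝ) - k + e) * (c / d) - e * (M / k)) := by
      rw [storageCut]
      field_simp
      push_cast
      ring
    rw [h1] at this
    have h2 : e * (M / k) ≤ ((d : ℝ) - k + e) * (c / d) := by linarith
    rw [← mul_div_assoc, ← mul_div_assoc, div_le_div_iff₀ hk0 hd0] at h2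
    rw [div_le_iff₀ (by positivity)]
    linarith

/-- The last cut does not involve `α` and fixes `γ`. Where it equals `M`, the cut before it exceeds
it by `e α - γ`, so `α ≥ γ / e`. -/
theorem isMBMR_of_dvd (hk : 1 ≤ k) (he : 1 ≤ e) (hkd : k ≤ d) (hdn : d + e ≤ n)
    (hM : 0 < M) (hT : k ≤ e * T) (hek : e < k) (hdvd : e ∣ k) {γ : ℝ}
    (hγ : γ = d * M / (d * (k / e : ℕ) - e * (Nat.choose (k / e) 2 : ℝ))) :
    γ = 2 * e * d * M / (-(k : ℝ) ^ 2 + e * k + 2 * k * d) ∧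
      IsMBMR n k d e T M (γ / e) γ := by
  have he0 : (0 : ℝ) < e := by exact_mod_cast he
  have hd0 : (0 : ℝ) < d := by exact_mod_cast (by omega : 0 < d)
  have hη : 1 ≤ k / e := Nat.div_pos hek.le he
  have hkk := cast_eq_div_mul_add_mod k e
  rw [Nat.mod_eq_zero_of_dvd hdvd, Nat.cast_zero, add_zero] at hkk
  set D : ℝ := d * (k / e : ℕ) - e * (Nat.choose (k / e) 2 : ℝ) with hD
  have hD1 : (k / e : ℕ) * ((d : ℝ) - k) + e * (k / e : ℕ) * ((k / e : ℕ) + 1) / 2 = D := by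
    rw [hD, Nat.cast_choose_two, hkk]
    ring
  have hD0 : 0 < D := hD1 ▸ storageCut_coeff_pos hkd he hη
  have hcut : ∀ α c : ℝ, storageCut k d e (k / e) α (c / d) = D * c / d := by
    intro α c
    rw [storageCut_div_of_dvd hdvd, hD1, mul_div_assoc]
  have hγ0 : 0 < γ := by rw [hγ]; positivity
  have hmem : Feasible M k d e (γ / e) (γ / d) := by
    refine feasible_of_increments (j := k / e) (by positivity) ?_ (fun _ => ?_)
      (fun h => absurd h (lt_irrefl _)) (fun h => absurd hdvd h)
    · rw [hcut, hγ]
      refine le_of_eq ?_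
      field_simp
    · rw [← hkk, sub_add_cancel, mul_div_cancel₀ _ hd0.ne', mul_div_cancel₀ _ he0.ne']
  refine ⟨?_, ?_⟩
  · have h1 : -(k : ℝ) ^ 2 + e * k + 2 * k * d = 2 * e * D := by
      rw [← hD1, hkk]
      ring
    rw [h1, hγ, mul_assoc (2 * (e : ℝ)), mul_div_mul_left _ _ (by positivity)]
  · simp only [IsMBMR, codesExist_iff_feasible hk he hkd hdn hM hT]
    refine ⟨⟨⟨_, hmem⟩, ?_⟩, hmem, ?_⟩
    · rintro c ⟨a, h⟩
      have h1 := h.storage (k / e) le_rfl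
      rw [hcut, le_div_iff₀ hd0] at h1
      rw [hγ, div_le_iff₀ hD0]
      linarith
    · intro a h
      have h1 := h.storage (k / e - 1) (Nat.sub_le _ _)
      have h2 := storageCut_sub k d e (k / e - 1) (k / e) a (γ / d)
      have h3 : storageCut k d e (k / e) a (γ / d) = M := by
        rw [hcut, hγ]
        field_simp
      rw [h3, Nat.cast_sub hη, Nat.cast_one] at h2
      have h4 : ((k / e : ℕ) - ((k / e : ℕ) - 1 : ℝ)) * (((d : ℝ) - k) * (γ / d) - e * a +
          e * ((k / e : ℕ) + ((k / e : ℕ) - 1 : ℝ) + 1) / 2 * (γ / d)) = γ - e * a := by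
        have h5 : d * (γ / d) = γ := mul_div_cancel₀ _ hd0.ne'
        rw [hkk]
        linear_combination h5
      rw [h4] at h2
      rw [div_le_iff₀ he0]
      linarith

/-- The download cut fixes `γ`, and the least `α` is the one at which the last storage cut equals
it. -/
theorem isMBMR_of_not_dvd (hk : 1 ≤ k) (he : 1 ≤ e) (hkd : k ≤ d) (hdn : d + e ≤ n)
    (hM : 0 < M) (hT : k ≤ e * T) (hdvd : ¬ e ∣ k) {γ : ℝ}
    (hγ : γ = d * M / (d * ((k / e : ℕ) + 1) - e * (Nat.choose (k / e + 1) 2 : ℝ))) :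
    γ = 2 * e * d * M / (((k : ℝ) - (k % e : ℕ) + e) * (2 * d - k + (k % e : ℕ))) ∧
      IsMBMR n k d e T M
        (γ * (d + (k / e : ℕ) * (k % e : ℕ) - e * (k / e : ℕ)) / ((k % e : ℕ) * d)) γ := by
  have he0 : (0 : ℝ) < e := by exact_mod_cast he
  have hd0 : (0 : ℝ) < d := by exact_mod_cast (by omega : 0 < d)
  have hr : (0 : ℝ) < (k % e : ℕ) := by
    exact_mod_cast Nat.pos_of_ne_zero fun h => hdvd (Nat.dvd_of_mod_eq_zero h)
  have hre : ((k % e : ℕ) : ℝ) ≤ e := by exact_mod_cast (Nat.mod_lt k he).le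
  have hkk := cast_eq_div_mul_add_mod k e
  have hkd' : (k : ℝ) ≤ d := by exact_mod_cast hkd
  have hη0 : (0 : ℝ) ≤ (k / e : ℕ) := Nat.cast_nonneg _
  set D : ℝ := d * ((k / e : ℕ) + 1) - e * (Nat.choose (k / e + 1) 2 : ℝ) with hD
  have hD1 : ((k / e : ℕ) + 1) * (d : ℝ) - e * (k / e : ℕ) * ((k / e : ℕ) + 1) / 2 = D := by
    rw [hD, ← choose_two_div]
    ring
  have hD0 : 0 < D := hD1 ▸ downloadCut_coeff_pos hk hkd
  have hcut : ∀ c : ℝ, downloadCut k d e (c / d) = D * c / d := by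
    intro c
    rw [downloadCut, hD1, mul_div_assoc]
  have hγ0 : 0 < γ := by rw [hγ]; positivity
  have hcutγ : downloadCut k d e (γ / d) = M := by
    rw [hcut, hγ]
    field_simp
  set α := γ * (d + (k / e : ℕ) * (k % e : ℕ) - e * (k / e : ℕ)) / ((k % e : ℕ) * d) with hα
  have hrα : (k % e : ℕ) * α =
      ((d : ℝ) + (k / e : ℕ) * (k % e : ℕ) - e * (k / e : ℕ)) * (γ / d) := by
    rw [hα]
    field_simp
  have hmem : Feasible M k d e α (γ / d) := by
    refine feasible_of_increments (j := k / e) (by positivity) ?_ (fun _ => ?_)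
      (fun h => absurd h (lt_irrefl _)) (fun _ => hcutγ.ge)
    · have := downloadCut_sub_storageCut k d e α (γ / d)
      rw [hrα, sub_self, hcutγ] at this
      linarith
    · refine le_of_mul_le_mul_left ?_ hr
      rw [mul_left_comm _ (e : ℝ), hrα, ← mul_assoc, ← mul_assoc]
      refine mul_le_mul_of_nonneg_right ?_ (by positivity)
      generalize ((k / e : ℕ) : ℝ) = η at *
      generalize ((k % e : ℕ) : ℝ) = r at *
      have h1 : 0 ≤ (e - r) * ((d : ℝ) - η * e) := mul_nonneg (by linarith) (by linarith)
      have h2 : 0 ≤ r * r := by positivity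
      rw [hkk]
      linarith
  refine ⟨?_, ?_⟩
  · have h1 : ((k : ℝ) - (k % e : ℕ) + e) * (2 * d - k + (k % e : ℕ)) = 2 * e * D := by
      rw [← hD1]
      generalize ((k / e : ℕ) : ℝ) = η at *
      generalize ((k % e : ℕ) : ℝ) = r at *
      rw [hkk]
      ring
    rw [h1, hγ, mul_assoc (2 * (e : ℝ)), mul_div_mul_left _ _ (by positivity)]
  · simp only [IsMBMR, codesExist_iff_feasible hk he hkd hdn hM hT]
    refine ⟨⟨⟨_, hmem⟩, ?_⟩, hmem, ?_⟩
    · rintro c ⟨a, h⟩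
      have h1 := h.download hdvd
      rw [hcut, le_div_iff₀ hd0] at h1
      rw [hγ, div_le_iff₀ hD0]
      linarith
    · intro a h
      have h1 := h.storage (k / e) le_rfl
      have h2 := downloadCut_sub_storageCut k d e a (γ / d)
      rw [hcutγ, ← hrα] at h2
      exact le_of_mul_le_mul_left (by linarith) hr

end extreme_points

/-! ### Specialization to the ranges of the statement. -/

section closed_forms

variable {k d e : ℕ} {M : ℝ}

theorem offset_div_self (hd : 1 ≤ d) : offset k d e (k % e) (k / e) = 0 := by
  rw [offset_eq hd le_rfl]
  simp

theorem breakpoint_nonneg (hM : 0 < M) (hk : 1 ≤ k) (he : 1 ≤ e) (hkd : k ≤ d) {i : ℕ}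
    (hi : i < k / e) : 0 ≤ breakpoint M k d e (k % e) i := by
  rw [breakpoint_eq (by omega) hi.le]
  have := breakpoint_den_pos he hk hkd hi
  positivity

theorem storageThreshold_eq_div (hM : 0 < M) (hk : 1 ≤ k) (he : 1 ≤ e) (hkd : k ≤ d)
    (hek : e ≤ k) {γ : ℝ} (hγ : breakpoint M k d e (k % e) (k / e - 1) ≤ γ) :
    storageThreshold M k d e γ = M / k := by
  have hη : 1 ≤ k / e := Nat.div_pos hek he
  have hmod := Nat.div_add_mod' k e
  rw [storageThreshold_eq_of_mem hk he hkd le_rfl (by omega)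
    ((breakpoint_nonneg hM hk he hkd (by omega)).trans hγ) (fun h => absurd h (lt_irrefl _))
    fun _ => hγ, offset_div_self (by omega), mul_zero, sub_zero, add_comm,
    ← cast_eq_div_mul_add_mod]

theorem storageThreshold_eq_div_of_le (hk : 1 ≤ k) (he : 1 ≤ e) (hkd : k ≤ d)
    (hke : k ≤ e) {γ : ℝ} (hγ : M ≤ γ) : storageThreshold M k d e γ = M / k := by
  refine eq_of_forall_ge_iff fun α => ?_
  have h1 := feasible_iff (M := M) hk he hkd γ α
  have hγmin : gammaMin M k d e = M := if_pos hke
  rw [feasible_iff_of_le hk he hkd hke, hγmin] at h1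
  tauto

theorem storageThreshold_eq_of_mem_Icc (hM : 0 < M) (hk : 1 ≤ k) (he : 1 ≤ e) (hkd : k ≤ d)
    {i : ℕ} (hi1 : 1 ≤ i) (hi : i ≤ k / e - 1) {γ : ℝ}
    (hγ : γ ∈ Set.Icc (breakpoint M k d e (k % e) (i - 1)) (breakpoint M k d e (k % e) i)) :
    storageThreshold M k d e γ =
      (M - γ * offset k d e (k % e) i) / ((k % e : ℕ) + i * e) :=
  storageThreshold_eq_of_mem hk he hkd (by omega) (Nat.add_pos_right _ (Nat.mul_pos hi1 he))
    ((breakpoint_nonneg hM hk he hkd (by omega)).trans hγ.1) (fun _ => hγ.2) fun _ => hγ.1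

end closed_forms

theorem theorem3 (n k d e : ℕ) (M : ℝ) (hk : 1 ≤ k) (he : 1 ≤ e) (hkd : k ≤ d)
    (hdn : d + e ≤ n) (hM : 0 < M) :
    -- the threshold, as a function of the total bandwidth `γ = d β`
    (∃ αstar : ℝ → ℝ,
      -- closed form: `k ≤ e`
      (k ≤ e → ∀ γ : ℝ, M ≤ γ → αstar γ = M / k) ∧
      -- closed form: `k = η e`, `η ≥ 2`
      (e < k → e ∣ k →
        (∀ γ : ℝ, breakpoint M k d e 0 (k / e - 1) ≤ γ → αstar γ = M / k) ∧
        (∀ i : ℕ, 1 ≤ i → i ≤ k / e - 1 →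
          ∀ γ ∈ Set.Icc (breakpoint M k d e 0 (i - 1)) (breakpoint M k d e 0 i),
            αstar γ = (M - γ * offset k d e 0 i) / (i * e))) ∧
      -- closed form: `k = η e + r`, `η ≥ 1`, `1 ≤ r ≤ e - 1`
      (e < k → ¬ e ∣ k →
        (∀ γ : ℝ, breakpoint M k d e (k % e) (k / e - 1) ≤ γ → αstar γ = M / k) ∧
        (∀ i : ℕ, 1 ≤ i → i ≤ k / e - 1 →
          ∀ γ ∈ Set.Icc (breakpoint M k d e (k % e) (i - 1)) (breakpoint M k d e (k % e) i),
            αstar γ = (M - γ * offset k d e (k % e) i) / ((k % e : ℕ) + i * e)) ∧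
        (∀ γ ∈ Set.Icc
            (d * M / (((k / e : ℕ) + 1) * d - e * (Nat.choose (k / e + 1) 2 : ℝ)))
            (breakpoint M k d e (k % e) 0),
          αstar γ = (M - γ * offset k d e (k % e) 0) / (k % e : ℕ))) ∧
      -- it is the threshold
      (∀ γ : ℝ, gammaMin M k d e ≤ γ → ∀ α : ℝ,
        (αstar γ ≤ α → ∀ T : ℕ,
          CodesExist n k d e T M α (γ / d) ∧
          ((αstar γ < α ∨ ∃ q : ℚ, α = q * (γ / d)) → HasCode n k d e T M α (γ / d))) ∧
        (α < αstar γ → ∀ T : ℕ, k ≤ e * T → ¬ CodesExist n k d e T M α (γ / d)))) ∧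
    -- no codes exist to the left of the range of `γ`
    (∀ γ : ℝ, γ < gammaMin M k d e → ∀ (α : ℝ) (T : ℕ), k ≤ e * T →
      ¬ CodesExist n k d e T M α (γ / d)) ∧
    -- the extreme points
    (∀ T : ℕ, k ≤ e * T →
      (k ≤ e → IsMSMR n k d e T M (M / k) M ∧ IsMBMR n k d e T M (M / k) M) ∧
      (e < k → IsMSMR n k d e T M (M / k) (M * e * d / (k * ((d : ℝ) - k + e)))) ∧
      (e < k → e ∣ k → ∀ γ : ℝ,
        γ = d * M / (d * (k / e : ℕ) - e * (Nat.choose (k / e) 2 : ℝ)) →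
        γ = 2 * e * d * M / (-(k : ℝ) ^ 2 + e * k + 2 * k * d) ∧
        IsMBMR n k d e T M (γ / e) γ) ∧
      (e < k → ¬ e ∣ k → ∀ γ : ℝ,
        γ = d * M / (d * ((k / e : ℕ) + 1) - e * (Nat.choose (k / e + 1) 2 : ℝ)) →
        γ = 2 * e * d * M /
          (((k : ℝ) - (k % e : ℕ) + e) * (2 * d - k + (k % e : ℕ))) ∧
        IsMBMR n k d e T M
          (γ * (d + (k / e : ℕ) * (k % e : ℕ) - e * (k / e : ℕ)) / ((k % e : ℕ) * d)) γ)) := by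
  have hd0 : (0 : ℝ) < d := by exact_mod_cast (by omega : 0 < d)
  have hiff := fun (T : ℕ) (hT : k ≤ e * T) (α γ : ℝ) =>
    codesExist_iff_feasible hk he hkd hdn hM hT α γ
  refine ⟨⟨storageThreshold M k d e, ?_, ?_, ?_, ?_⟩, ?_, ?_⟩
  · exact fun hke γ hγ => storageThreshold_eq_div_of_le hk he hkd hke hγ
  · intro hek hdvd
    have hmod := Nat.mod_eq_zero_of_dvd hdvd
    refine ⟨fun γ hγ => storageThreshold_eq_div hM hk he hkd hek.le (by rwa [hmod]),
      fun i hi1 hi γ hγ => ?_⟩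
    have := storageThreshold_eq_of_mem_Icc hM hk he hkd hi1 hi (γ := γ) (by rwa [hmod])
    rwa [hmod, Nat.cast_zero, zero_add] at this
  · intro hek hdvd
    refine ⟨fun γ hγ => storageThreshold_eq_div hM hk he hkd hek.le hγ,
      fun i hi1 hi γ hγ => storageThreshold_eq_of_mem_Icc hM hk he hkd hi1 hi hγ,
      fun γ hγ => ?_⟩
    have hγmin : gammaMin M k d e ≤ γ := by
      rw [gammaMin, if_neg (by omega), if_neg hdvd]
      exact hγ.1
    have hr : 0 < k % e := Nat.pos_of_ne_zero fun h => hdvd (Nat.dvd_of_mod_eq_zero h)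
    have := storageThreshold_eq_of_mem hk he hkd (Nat.zero_le _) (by omega)
      ((gammaMin_pos hM hk he hkd).le.trans hγmin) (fun _ => hγ.2) (by omega)
    simpa using this
  · intro γ hγ α
    have hβ : 0 < γ / d := div_pos ((gammaMin_pos hM hk he hkd).trans_le hγ) hd0
    refine ⟨fun hα T => ?_, fun hα T hT hC => ?_⟩
    · have hf := (feasible_iff hk he hkd γ α).2 ⟨hγ, hα⟩
      refine ⟨hf.codesExist hM hβ hkd T, ?_⟩
      rintro (hlt | ⟨q, hq⟩)
      -- Strict inequality leaves room for a rational ratio between the threshold and `α`, so no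
      -- file size is lost.
      · obtain ⟨q, hq1, hq2⟩ := exists_rat_mul_between hβ hlt
        exact (((feasible_iff hk he hkd γ _).2 ⟨hγ, hq1.le⟩).hasCode_of_rat hM hβ hkd q rfl
          T).mono le_rfl hq2.le
      · exact hf.hasCode_of_rat hM hβ hkd q hq T
    · exact hα.not_ge ((feasible_iff hk he hkd γ α).1 ((hiff T hT α γ).1 hC)).2
  · exact fun γ hγ α T hT hC =>
      hγ.not_ge ((feasible_iff hk he hkd γ α).1 ((hiff T hT α γ).1 hC)).1
  · intro T hT
    exact ⟨isMSMR_and_isMBMR_of_le hk he hkd hdn hM hT, isMSMR_of_lt hk he hkd hdn hM hT,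
      fun hek hdvd γ hγ => isMBMR_of_dvd hk he hkd hdn hM hT hek hdvd hγ,
      fun _ hdvd γ hγ => isMBMR_of_not_dvd hk he hkd hdn hM hT hdvd hγ⟩
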